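/- **Notation.** For $n\ge 1$ and $p\in(0,1)$ write $N=np(1-p)$. Let $\mu_p$ be the $p$-biased product measure on $\{0,1\}^n$, $\mu_p(x)=p^{\sum_i x_i}(1-p)^{\sum_i(1-x_i)}$. For $0\le k\le n$ let $\nu_k$ be the uniform measure on the slice $\{x\in\{0,1\}^n:\sum_i x_i=k\}$, and let $\sigma(k)=(k-np)/\sqrt N$. Write $\|f\|_{\nu}=\sqrt{\mathbb E_\nu[f^2]}$. A polynomial is multilinear if all its monomials are squarefree, and $\varphi:\mathbb R\to\mathbb R$ is Lipschitz if $|\varphi(x)-\varphi(y)|\le|x-y|$ for all $x,y$. Integers $k_1,\dots,k_{d+1}\in\{0,\dots,n\}$ form an $(\eta,M)$-system, where $0<\eta\le1\le M$, if the numbers $\sigma_i=\sigma(k_i)$ satisfy $|\sigma_i-\sigma_j|\ge\eta$ for $i\ne j$ and $|\sigma_i|\le M$ for all $i$. Let $\pi$ be a uniformly random permutation of $\{1,\dots,n\}$, and for $0\le s\le n$ let $X(s)\in\{0,1\}^n$ be the indicator vector of $\pi(\{1,\dots,s\})$. The profile of $f$ with respect to $k_1,\dots,k_{d+1}$ is the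 joint distribution $(\mathbf f_1,\dots,\mathbf f_{d+1})$ of $f(X(k_1)),\dots,f(X(k_{d+1}))$. Let $V$ be the Vandermonde matrix $V_{ie}=\sigma_i^e$ ($1\le i\le d+1$, $0\le e\le d$). For $t\in\mathbb R$ define the weights $\gamma_i(t)=\sum_{e=0}^d t^e\,(V^{-1})_{ei}$; they depend only on $t$ and $\sigma_1,\dots,\sigma_{d+1}$, and not on $f$. **Theorem.** There exist absolute constants $K,C>0$ and $A\in\mathbb N$ such that the following holds. Let $n\geq 1$ be an integer, let $p\in(0,1)$, and let $f$ be a multilinear polynomial in $x_1,\dots,x_n$ with real coefficients of degree at most $d$, where $1\le d\le K\sqrt{N/\log N}$. Let $k_1,\dots,k_{d+1}$ be an $(\eta,M)$-system with $M\le\sqrt N/(9d)$, and suppose that $\|f\|_{\nu_{k_i}}\le1$ for $1\le i\le d+1$. (These hypotheses force $N\ge 81$.) Then for every $0\le k\le n$ and $1\le i\le d+1$, $$|\gamma_i(\sigma(k))|\le\Bigl(C\,(1+|\sigma(k)|)\,\frac M\eta\Bigr)^d .$$ Moreover, put $s=\sqrt{3\log N}$, let $B\sim\mathrm{Bin}(n,p)$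 be conditioned on $|\sigma(B)|\le s$, independently of the profile, and let $\mathbf f=\sum_{i=1}^{d+1}\gamma_i(\sigma(B))\,\mathbf f_i$. Then for every Lipschitz function $\varphi$, $$\bigl|\mathbb E_{\mu_p}[\varphi(f)]-\mathbb E[\varphi(\mathbf f)]\bigr|\le\Bigl(C\,\frac{d}{p(1-p)}\cdot\frac M\eta\Bigr)^{A d}\,\frac1{(np(1-p))^{1/4}} .$$ -/

import Mathlib

open MeasureTheory ProbabilityTheory

noncomputable section

namespace SliceInterp

/-- A polynomial is multilinear if all its monomials are squarefree. -/
def IsMultilinear {n : ℕ} (f : MvPolynomial (Fin n) ℝ) : Prop :=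
  f ∈ MvPolynomial.restrictDegree (Fin n) ℝ 1

/-- The slice of level `k`: the points of `{0,1}^n` with coordinate sum `k`. -/
def slice (n k : ℕ) : Set (Fin n → ℝ) :=
  {x | (∀ i, x i = 0 ∨ x i = 1) ∧ ∑ i, x i = (k : ℝ)}

/-- `ν_k`, the uniform measure on the slice of level `k`. -/
def sliceMeasure (n k : ℕ) : Measure (Fin n → ℝ) :=
  uniformOn (slice n k)

/-- `μ_p`, the `p`-biased product measure on `{0,1}^n`. -/
def cubeMeasure (n : ℕ) (p : unitInterval) : Measure (Fin n → ℝ) :=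
  Measure.pi fun _ : Fin n => bernoulliMeasure (1 : ℝ) 0 p

/-- The `L₂` norm of a polynomial with respect to a measure. -/
def l2Norm {n : ℕ} (ν : Measure (Fin n → ℝ)) (f : MvPolynomial (Fin n) ℝ) : ℝ :=
  Real.sqrt (∫ x, (MvPolynomial.eval x f) ^ 2 ∂ν)

/-- The variance `np(1-p)` of the binomial distribution. -/
def binVar (n : ℕ) (p : ℝ) : ℝ := n * p * (1 - p)

/-- The standardised level `σ = (k - np) / √(np(1-p))`. -/
def stdLevel (n : ℕ) (p : ℝ) (k : ℕ) : ℝ :=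
  ((k : ℝ) - n * p) / Real.sqrt (binVar n p)

/-- `k 0, …, k (r-1)` is an `(η, M)`-system of levels in `{0, …, n}`. -/
structure IsSystem (n : ℕ) (p η M : ℝ) {r : ℕ} (k : Fin r → ℕ) : Prop where
  eta_pos : 0 < η
  eta_le_one : η ≤ 1
  one_le_M : 1 ≤ M
  le_n : ∀ i, k i ≤ n
  separated : ∀ i j, i ≠ j → η ≤ |stdLevel n p (k i) - stdLevel n p (k j)|
  bounded : ∀ i, |stdLevel n p (k i)| ≤ M

/-- The chain `X(s)` attached to a permutation `π`: the indicator vector of the image under `π`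
of the first `s` indices. For uniformly random `π` this is the coupling of all slices. -/
def chain {n : ℕ} (π : Equiv.Perm (Fin n)) (s : ℕ) : Fin n → ℝ :=
  fun i => if (π.symm i : ℕ) < s then 1 else 0

/-- The profile of `f` with respect to the levels `k`: the joint law of the values `f(X(k i))`,
where `X` is the chain of a uniformly random permutation. -/
def profile {n r : ℕ} (f : MvPolynomial (Fin n) ℝ) (k : Fin r → ℕ) : Measure (Fin r → ℝ) :=
  ((PMF.uniformOfFintype (Equiv.Perm (Fin n))).map
    fun π => fun i => MvPolynomial.eval (chain π (k i)) f).toMeasure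

/-- The weights `γ_i(t) = ∑_e t^e (V⁻¹)_{e i}`, where `V_{i e} = σ_i^e` is the Vandermonde matrix
of the standardised levels `σ_i` of the system. -/
def weight (n : ℕ) (p : ℝ) {r : ℕ} (k : Fin r → ℕ) (t : ℝ) (i : Fin r) : ℝ :=
  ∑ e : Fin r, t ^ (e : ℕ) * (Matrix.vandermonde fun j => stdLevel n p (k j))⁻¹ e i

/-- The binomial distribution `Bin(n, p)` of the level `l`, conditioned on the standardised level
`σ` of `l` satisfying `|σ| ≤ s`. -/
def condBinomial (n : ℕ) (p : unitInterval) (s : ℝ) : Measure ℕ :=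
  ProbabilityTheory.cond (binomial n p) {l | |stdLevel n p l| ≤ s}

/-- The random linear combination `∑ i, γ_i(σ) f_i`, where `(f_i)` is distributed as the profile of
`f` and `σ` is the standardised level of an independent conditioned binomial variable. -/
def interpolated {n r : ℕ} (p : unitInterval) (f : MvPolynomial (Fin n) ℝ) (k : Fin r → ℕ)
    (s : ℝ) : Measure ℝ :=
  ((condBinomial n p s).prod (profile f k)).map
    fun z => ∑ i, weight n p k (stdLevel n p z.1) i * z.2 i

end SliceInterp

end

/-!
Write `X(a)` for the chain of a random permutation at time `a`, `F(a) = f(X(a))`, and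
`N = n p (1 - p)`. The proof rests on two facts about a function `f` of degree at most `d`.

*Interpolation is exact after conditioning.* For `a ≤ m`, the conditional expectation of a monomial
of degree `s` in `X(a)` given `X(m)` is `a(a-1)⋯(a-s+1) / m(m-1)⋯(m-s+1)` times the same monomial in
`X(m)` (`expect_ev_mul_eq_rescale`), so `G(a) = E[F(a) | X(m)]` is a polynomial of degree at most
`d` in `a`. The weights `γ_i` are the Lagrange basis polynomials of the nodes, whence
`G(l) = ∑ i, γ_i(σ(l)) G(k_i)` as soon as `m` is at least `l` and all the `k_i`.

*Conditioning loses little.* The backward martingale `E[F(a) | X(b)]`, `b = a, a + 1, …`, loses in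
each step at most a fraction `d (n + 1) / ((b + 1) (n - b)) = O(d / N)` of its squared norm, because
the operator "remove an element, then add one" on a slice is symmetric and triangular with respect
to the degree, with explicit diagonal entries (`shadowSum_energy`, `flag_form_lower_bound`). The
levels involved are at distance `O(M (1 + |σ(l)|) √N)`, so `F(a) - G(a)` has squared norm
`O(d M (1 + |σ(l)|) / √N)` times that of `F(a)` (`expect_sq_sub_rescale_le`). Taking square roots
gives the factor `N ^ (-1 / 4)`.

The first fact also bounds the norm of `F(l)` by the sum of the `|γ_i(σ(l))|`: with `m = l` when `l`
is above all the levels, after complementing all coordinates when it is below them, and, when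
`|σ(l)| ≤ M`, because conditioning loses at most half of the squared norm
(`IsSystem.expect_sq_le`). Together these give the `L₁` estimate at a single level
(`IsSystem.expect_abs_sub_le`).

It remains to average over the binomial level. Powers of `1 + |σ|` have bounded moments, and the
levels with `|σ| > √(3 log N)` have probability `O(N ^ (-1 / 2))`, so that by the Cauchy–Schwarz
inequality they contribute `O(N ^ (-1 / 4))` (`abs_sum_sub_conditioned_le`).
-/

namespace SliceInterp

open Finset
open scoped BigOperators

section LowDegree

/-! ### Triangular symmetric operators -/

/-- A symmetric operator that is triangular with respect to a flag, with diagonal entries at least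
`c`, has quadratic form at least `c` on the flag: split off the orthogonal complement of each step,
on which the form is exactly the diagonal entry. -/
theorem flag_form_lower_bound {E : Type*} [NormedAddCommGroup E] [InnerProductSpace ℝ E]
    [FiniteDimensional ℝ E] (T : E →ₗ[ℝ] E) (hT : T.IsSymmetric) (W : ℕ → Submodule ℝ E)
    (hW : ∀ s, W s ≤ W (s + 1)) (μ : ℕ → ℝ) (h0 : ∀ w ∈ W 0, T w = μ 0 • w)
    (hs : ∀ s, ∀ w ∈ W (s + 1), T w - μ (s + 1) • w ∈ W s) (c : ℝ) (d : ℕ)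
    (hc : ∀ s ≤ d, c ≤ μ s) :
    ∀ v ∈ W d, c * ‖v‖ ^ 2 ≤ inner ℝ (T v) v := by
  have hTW : ∀ s, ∀ w ∈ W s, T w ∈ W s := by
    intro s w hw
    cases s with
    | zero => rw [h0 w hw]; exact (W 0).smul_mem _ hw
    | succ s =>
      have := (W (s + 1)).add_mem (hW s (hs s w hw)) ((W (s + 1)).smul_mem (μ (s + 1)) hw)
      simpa using this
  induction d with
  | zero =>
    intro v hv
    rw [h0 v hv, inner_smul_left, real_inner_self_eq_norm_sq]
    exact mul_le_mul_of_nonneg_right (hc 0 le_rfl) (by positivity)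
  | succ d ih =>
    intro v hv
    obtain ⟨u, hu, w, hw, rfl⟩ := (W d).exists_add_mem_mem_orthogonal v
    have hwW : w ∈ W (d + 1) := by
      have := (W (d + 1)).sub_mem hv (hW d hu)
      simpa using this
    have hort : ∀ z ∈ W d, inner ℝ z w = 0 := fun z hz => hw z hz
    have h1 : inner ℝ (T u) w = 0 := hort _ (hTW d u hu)
    have h2 : inner ℝ (T w) u = 0 := by rw [hT w u, real_inner_comm]; exact h1
    have h3 : inner ℝ (T w) w = μ (d + 1) * ‖w‖ ^ 2 := by
      have := hort _ (hs d w hwW)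
      rw [inner_sub_left, inner_smul_left, real_inner_self_eq_norm_sq] at this
      simp only [conj_trivial] at this
      linarith
    have h4 : ‖u + w‖ ^ 2 = ‖u‖ ^ 2 + ‖w‖ ^ 2 := by
      rw [← real_inner_self_eq_norm_sq, inner_add_left, inner_add_right, inner_add_right,
        hort u hu, real_inner_comm u w, hort u hu, real_inner_self_eq_norm_sq,
        real_inner_self_eq_norm_sq]
      ring
    rw [map_add, inner_add_left, inner_add_right, inner_add_right, h1, h2, h3, h4]
    have := ih (fun s hs => hc s (by omega)) u hu
    have := mul_le_mul_of_nonneg_right (hc (d + 1) le_rfl) (sq_nonneg ‖w‖)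
    linarith

/-! ### Functions of low degree on the slices -/

variable {n : ℕ}

/-- The sum of `g` over all sets obtained from `y` by removing an element. -/
def shadowSum (g : Finset (Fin n) → ℝ) (y : Finset (Fin n)) : ℝ := ∑ i ∈ y, g (y.erase i)

/-- The sum of `h` over all sets obtained from `x` by adding an element. -/
def coshadowSum (h : Finset (Fin n) → ℝ) (x : Finset (Fin n)) : ℝ := ∑ i ∈ xᶜ, h (insert i x)

/-- `shadowSum` and `coshadowSum` are adjoint for the counting measure. -/
theorem sum_shadowSum_mul (g h : Finset (Fin n) → ℝ) :
    ∑ y, shadowSum g y * h y = ∑ x, g x * coshadowSum h x := by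
  have e1 : ∀ y, shadowSum g y * h y = ∑ i, if i ∈ y then g (y.erase i) * h y else 0 := by
    intro y
    rw [shadowSum, sum_mul, ← sum_filter]
    simp
  have e2 : ∀ x, g x * coshadowSum h x = ∑ i, if i ∉ x then g x * h (insert i x) else 0 := by
    intro x
    rw [coshadowSum, mul_sum, ← sum_filter]
    refine sum_congr ?_ fun _ _ => rfl
    ext; simp
  simp_rw [e1, e2]
  rw [sum_comm, sum_comm (s := (univ : Finset (Finset (Fin n))))]
  refine sum_congr rfl fun i _ => ?_
  rw [← sum_filter, ← sum_filter]
  refine sum_nbij' (fun y => y.erase i) (fun x => insert i x) ?_ ?_ ?_ ?_ ?_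
  · simp
  · simp
  · intro y hy; exact insert_erase (by simpa using hy)
  · intro x hx; exact erase_insert (by simpa using hx)
  · intro y hy
    rw [insert_erase (by simpa using hy)]

/-- The value at the indicator vector of `x` of the multilinear polynomial `∑ S, c S * ∏ i ∈ S, x i`.
A function of degree at most `d` is one for which `c` vanishes on sets of more than `d` elements. -/
def ev (c : Finset (Fin n) → ℝ) (x : Finset (Fin n)) : ℝ := ∑ S ∈ x.powerset, c S

theorem ev_eq (c : Finset (Fin n) → ℝ) (x : Finset (Fin n)) :
    ev c x = ∑ S, if S ⊆ x then c S else 0 := by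
  rw [ev, ← sum_filter]
  refine sum_congr ?_ fun _ _ => rfl
  ext; simp

/-- The monomial of `S`, restricted to the slice of level `a` and extended by zero. -/
def sliceMonomial (a : ℕ) (S x : Finset (Fin n)) : ℝ := if x.card = a ∧ S ⊆ x then 1 else 0

theorem shadowSum_sliceMonomial (a : ℕ) (S : Finset (Fin n)) :
    shadowSum (sliceMonomial a S) = ((a : ℝ) + 1 - S.card) • sliceMonomial (a + 1) S := by
  ext y
  simp only [shadowSum, sliceMonomial, Pi.smul_apply, smul_eq_mul]
  by_cases hy : y.card = a + 1
  · by_cases hS : S ⊆ y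
    · have h1 : ∀ i ∈ y, (if (y.erase i).card = a ∧ S ⊆ y.erase i then (1 : ℝ) else 0) =
          1 - if i ∈ S then 1 else 0 := by
        intro i hi
        have : (y.erase i).card = a := by rw [card_erase_of_mem hi]; omega
        by_cases hiS : i ∈ S
        · rw [if_neg, if_pos hiS]; · simp
          exact fun h => by simpa using h.2 hiS
        · rw [if_pos ⟨this, subset_erase.2 ⟨hS, hiS⟩⟩, if_neg hiS]; simp
      rw [sum_congr rfl h1, if_pos ⟨hy, hS⟩, sum_sub_distrib, ← sum_filter]
      have : y.filter (· ∈ S) = S := by ext; simpa using fun h => hS h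
      simp [this, hy]
    · rw [if_neg (fun h => hS h.2), mul_zero]
      refine sum_eq_zero fun i _ => if_neg fun h => hS (h.2.trans (erase_subset _ _))
  · rw [if_neg (fun h => hy h.1), mul_zero]
    refine sum_eq_zero fun i hi => if_neg fun h => hy ?_
    have := card_erase_of_mem hi
    have := card_pos.2 ⟨i, hi⟩
    omega

theorem coshadowSum_sliceMonomial (a : ℕ) (S : Finset (Fin n)) :
    coshadowSum (sliceMonomial (a + 1) S) =
      ((n : ℝ) - a - S.card) • sliceMonomial a S + ∑ i ∈ S, sliceMonomial a (S.erase i) := by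
  ext x
  simp only [coshadowSum, sliceMonomial, Pi.smul_apply, smul_eq_mul, Pi.add_apply,
    Finset.sum_apply]
  by_cases hx : x.card = a
  · have h1 : ∀ i ∈ xᶜ, (if (insert i x).card = a + 1 ∧ S ⊆ insert i x then (1 : ℝ) else 0) =
        if S.erase i ⊆ x then 1 else 0 := by
      intro i hi
      have : (insert i x).card = a + 1 := by rw [card_insert_of_notMem (by simpa using hi), hx]
      simp [this, subset_insert_iff]
    rw [sum_congr rfl h1]
    simp only [hx, true_and]
    have h2 : ∀ i, (if i ∈ xᶜ then (if S.erase i ⊆ x then (1 : ℝ) else 0) else 0) -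
        (if i ∈ S then (if S.erase i ⊆ x then (1 : ℝ) else 0) else 0) =
        (if S ⊆ x then 1 else 0) * ((if i ∈ xᶜ then (1 : ℝ) else 0) - if i ∈ S then 1 else 0) := by
      intro i
      by_cases h1 : i ∈ x <;> by_cases h2 : i ∈ S
      · simp [h1, h2, ← subset_insert_iff]
      · simp [h1, h2]
      · simp [h1, h2]
      · simp [h1, h2, erase_eq_of_notMem]
    have h3 := sum_congr (rfl : (univ : Finset (Fin n)) = univ) fun i _ => h2 i
    rw [← mul_sum, sum_sub_distrib, sum_sub_distrib] at h3
    simp only [sum_ite_mem, univ_inter, sum_const, nsmul_eq_mul, mul_one, card_compl,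
      Fintype.card_fin, hx] at h3
    rw [Nat.cast_sub (hx ▸ card_finset_fin_le x)] at h3
    linarith
  · simp only [hx, false_and, if_false, mul_zero, zero_add, sum_const_zero]
    refine sum_eq_zero fun i hi => if_neg fun h => hx ?_
    have := card_insert_of_notMem (a := i) (s := x) (by simpa using hi)
    omega

/-- Lower bound for the norm of the average over removed elements of a function of degree `d` on the
slice of level `a`. The operator `coshadowSum ∘ shadowSum` is triangular on the monomials filtered
by degree, with eigenvalue `(a + 1 - s) (n - a - s)` in degree `s`. -/
theorem shadowSum_energy (c : Finset (Fin n) → ℝ) (d a : ℕ) (hc : ∀ S, d < S.card → c S = 0)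
    (g : Finset (Fin n) → ℝ) (hg : ∀ x, g x = if x.card = a then ev c x else 0) :
    (((a : ℝ) + 1) * (n - a) - d * (n + 1)) * ∑ x, g x ^ 2 ≤ ∑ y, shadowSum g y ^ 2 := by
  let T : EuclideanSpace ℝ (Finset (Fin n)) →ₗ[ℝ] EuclideanSpace ℝ (Finset (Fin n)) :=
    { toFun := fun v => WithLp.toLp 2 (coshadowSum (shadowSum v))
      map_add' := by
        intro v w; ext x
        simp [coshadowSum, shadowSum, sum_add_distrib]
      map_smul' := by
        intro r v; ext x
        simp [coshadowSum, shadowSum, mul_sum] }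
  have hin : ∀ v w : EuclideanSpace ℝ (Finset (Fin n)), inner ℝ (T v) w = ∑ y, shadowSum w y * shadowSum v y := by
    intro v w
    rw [sum_shadowSum_mul]
    simp [PiLp.inner_apply, T]
  have hT : T.IsSymmetric := by
    intro v w
    rw [hin, real_inner_comm, hin]
    exact sum_congr rfl fun _ _ => mul_comm _ _
  let m : Finset (Fin n) → EuclideanSpace ℝ (Finset (Fin n)) := fun S => WithLp.toLp 2 (sliceMonomial a S)
  let W : ℕ → Submodule ℝ (EuclideanSpace ℝ (Finset (Fin n))) := fun s => Submodule.span ℝ (m '' {S | S.card ≤ s})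
  have hmW : ∀ s S, S.card ≤ s → m S ∈ W s := fun s S h => Submodule.subset_span ⟨S, h, rfl⟩
  have hWmono : ∀ s t, s ≤ t → W s ≤ W t := fun s t h =>
    Submodule.span_mono (Set.image_mono fun S (hS : S.card ≤ s) => hS.trans h)
  let μ : ℕ → ℝ := fun s => ((a : ℝ) + 1 - s) * (n - a - s)
  have hTm : ∀ S, T (m S) = μ S.card • m S +
      ((a : ℝ) + 1 - S.card) • ∑ i ∈ S, m (S.erase i) := by
    intro S
    have hlin : ∀ (r : ℝ) (h : Finset (Fin n) → ℝ), coshadowSum (r • h) = r • coshadowSum h := by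
      intro r h; ext x; simp [coshadowSum, mul_sum]
    ext x
    simp only [T, m, μ, LinearMap.coe_mk, AddHom.coe_mk, shadowSum_sliceMonomial, hlin,
      coshadowSum_sliceMonomial]
    simp only [Pi.smul_apply, Pi.add_apply, smul_eq_mul, Finset.sum_apply, PiLp.add_apply,
      PiLp.smul_apply, WithLp.ofLp_sum]
    ring
  have h0 : ∀ w ∈ W 0, T w = μ 0 • w := by
    intro w hw
    refine Submodule.span_induction (p := fun w _ => T w = μ 0 • w) ?_ (by simp)
      (fun x y _ _ hx hy => by rw [map_add, hx, hy, smul_add])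
      (fun r x _ hx => by rw [map_smul, hx, smul_comm]) hw
    rintro _ ⟨S, hS, rfl⟩
    have hS0 : S = ∅ := by simpa using hS
    subst hS0
    rw [hTm]; simp
  -- Modulo lower degree, `T` acts on degree `s + 1` as the scalar `μ (s + 1)`.
  have hs : ∀ s, ∀ w ∈ W (s + 1), T w - μ (s + 1) • w ∈ W s := by
    intro s w hw
    refine Submodule.span_induction (p := fun w _ => T w - μ (s + 1) • w ∈ W s) ?_ (by simp)
      (fun x y _ _ hx hy => by
        have := (W s).add_mem hx hy
        rw [map_add, smul_add]; convert this using 1; abel)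
      (fun r x _ hx => by
        have := (W s).smul_mem r hx
        rw [map_smul, smul_comm, ← smul_sub]; exact this) hw
    rintro _ ⟨S, hS, rfl⟩
    have hS' : S.card ≤ s + 1 := hS
    have hrest : ((a : ℝ) + 1 - S.card) • ∑ i ∈ S, m (S.erase i) ∈ W s := by
      refine (W s).smul_mem _ ((W s).sum_mem fun i hi => hmW _ _ ?_)
      rw [card_erase_of_mem hi]; omega
    rw [hTm]
    rcases hS'.lt_or_eq with h | h
    · have := hmW s S (by omega)
      exact (W s).sub_mem ((W s).add_mem ((W s).smul_mem _ this) hrest) ((W s).smul_mem _ this)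
    · rw [h, add_sub_cancel_left, ← h]; exact hrest
  have hμ : ∀ s ≤ d, ((a : ℝ) + 1) * (n - a) - d * (n + 1) ≤ μ s := by
    intro s hsd
    have : (s : ℝ) ≤ d := by exact_mod_cast hsd
    have h2 : (s : ℝ) * (n + 1) ≤ d * (n + 1) := mul_le_mul_of_nonneg_right this (by positivity)
    simp only [μ]
    nlinarith [sq_nonneg (s : ℝ)]
  have hgW : WithLp.toLp 2 g ∈ W d := by
    have : (WithLp.toLp 2 g : EuclideanSpace ℝ (Finset (Fin n))) = ∑ S, c S • m S := by
      ext x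
      simp only [m, WithLp.ofLp_sum, Finset.sum_apply, PiLp.smul_apply, smul_eq_mul,
        sliceMonomial, hg, ev_eq]
      by_cases hx : x.card = a <;> simp [hx]
    rw [this]
    refine (W d).sum_mem fun S _ => ?_
    by_cases hS : d < S.card
    · rw [hc S hS, zero_smul]; exact (W d).zero_mem
    · exact (W d).smul_mem _ (hmW _ _ (by omega))
  have := flag_form_lower_bound T hT W (fun s => hWmono s _ (by omega)) μ h0 hs _ d hμ _ hgW
  rw [hin, EuclideanSpace.norm_sq_eq] at this
  simpa [sq] using this

end LowDegree

section Chain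

variable {n : ℕ}

/-! ### The random chain of slices -/

/-- The chain of a permutation `π` at time `s`, as the set `π {0, …, s - 1}`. -/
def prefixSet (π : Equiv.Perm (Fin n)) (s : ℕ) : Finset (Fin n) :=
  univ.filter fun i => (π.symm i : ℕ) < s

theorem mem_prefixSet {π : Equiv.Perm (Fin n)} {s : ℕ} {i : Fin n} :
    i ∈ prefixSet π s ↔ (π.symm i : ℕ) < s := by simp [prefixSet]

theorem prefixSet_eq_map (π : Equiv.Perm (Fin n)) (s : ℕ) :
    prefixSet π s = (univ.filter fun j : Fin n => (j : ℕ) < s).map π.toEmbedding := by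
  ext i
  rw [mem_prefixSet, mem_map_equiv]
  simp

theorem card_prefixSet (π : Equiv.Perm (Fin n)) {s : ℕ} (hs : s ≤ n) :
    (prefixSet π s).card = s := by
  rw [prefixSet_eq_map, card_map, Fin.card_filter_val_lt, min_eq_right hs]

theorem exists_perm_map_eq {x y : Finset (Fin n)} (h : x.card = y.card) :
    ∃ τ : Equiv.Perm (Fin n), x.map τ.toEmbedding = y := by
  let e : {i // i ∈ x} ≃ {i // i ∈ y} := x.equivOfCardEq h
  refine ⟨e.extendSubtype, eq_of_subset_of_card_le ?_ (by simp [h])⟩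
  intro i hi
  obtain ⟨j, hj, rfl⟩ := mem_map.1 hi
  exact e.extendSubtype_mem j hj

theorem expect_prefixSet (g : Finset (Fin n) → ℝ) {k : ℕ} (hk : k ≤ n) :
    𝔼 π : Equiv.Perm (Fin n), g (prefixSet π k) =
      (∑ x ∈ powersetCard k univ, g x) / n.choose k := by
  -- The number of permutations leading to a given set depends only on its cardinality.
  let N : Finset (Fin n) → ℕ := fun x =>
    (univ.filter fun π : Equiv.Perm (Fin n) => prefixSet π k = x).card
  have hN : ∀ x y : Finset (Fin n), x.card = y.card → N x = N y := by
    intro x y hxy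
    obtain ⟨τ, rfl⟩ := exists_perm_map_eq hxy
    refine card_bij' (fun π _ => τ * π) (fun π _ => τ⁻¹ * π) ?_ ?_ ?_ ?_
    · intro π hπ
      have : prefixSet π k = x := by simpa using hπ
      simp only [mem_filter, mem_univ, true_and, prefixSet_eq_map] at this ⊢
      rw [← this, map_map]; rfl
    · intro π hπ
      have : prefixSet π k = x.map τ.toEmbedding := by simpa using hπ
      simp only [mem_filter, mem_univ, true_and]
      ext i
      have h2 := Finset.ext_iff.1 this (τ i)
      rw [mem_prefixSet, mem_map_equiv, Equiv.symm_apply_apply] at h2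
      rw [mem_prefixSet, ← h2]; rfl
    · simp
    · simp
  have hsum : ∀ h : Finset (Fin n) → ℝ, ∑ π : Equiv.Perm (Fin n), h (prefixSet π k) =
      ∑ x ∈ powersetCard k univ, N x * h x := by
    intro h
    rw [← sum_fiberwise_of_maps_to (t := powersetCard k univ) (g := fun π => prefixSet π k)
      (by simp [card_prefixSet, hk])]
    refine sum_congr rfl fun x _ => ?_
    rw [sum_congr rfl (g := fun _ => h x) (fun π hπ => by rw [(mem_filter.1 hπ).2])]
    simp [N]
  obtain ⟨x₀, hx₀⟩ : ∃ x₀ : Finset (Fin n), x₀.card = k := ⟨prefixSet 1 k, card_prefixSet 1 hk⟩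
  have hsum' : ∀ h : Finset (Fin n) → ℝ, ∑ π : Equiv.Perm (Fin n), h (prefixSet π k) =
      N x₀ * ∑ x ∈ powersetCard k univ, h x := by
    intro h
    rw [hsum, mul_sum]
    exact sum_congr rfl fun x hx => by rw [hN x x₀ (by rw [hx₀]; simpa using hx)]
  have h1 := hsum' fun _ => 1
  simp only [sum_const, card_univ, nsmul_eq_mul, mul_one, card_powersetCard, Fintype.card_fin]
    at h1
  have hpos : (0 : ℝ) < Fintype.card (Equiv.Perm (Fin n)) := by exact_mod_cast Fintype.card_pos
  have hc : (0 : ℝ) < n.choose k := by exact_mod_cast Nat.choose_pos hk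
  have hN0 : (N x₀ : ℝ) ≠ 0 := by intro h0; rw [h0, zero_mul] at h1; exact hpos.ne' h1
  rw [Fintype.expect_eq_sum_div_card, hsum', h1]
  field_simp

/-- Conditionally on the later sets of the chain, the element added at time `a + 1` is uniform in
the set reached at that time. -/
theorem expect_prefixSet_step {a : ℕ} (ha : a < n) (f : Finset (Fin n) → ℝ)
    {m : ℕ} (hm : a + 1 ≤ m) (G : Finset (Fin n) → ℝ) :
    𝔼 π : Equiv.Perm (Fin n), f (prefixSet π a) * G (prefixSet π m) =
      𝔼 π : Equiv.Perm (Fin n),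
        shadowSum f (prefixSet π (a + 1)) / (a + 1) * G (prefixSet π m) := by
  let J : Finset (Fin n) := univ.filter fun j => (j : ℕ) < a + 1
  have hJ : (J.card : ℝ) = a + 1 := by
    rw [Fin.card_filter_val_lt, min_eq_right (by omega)]; push_cast; rfl
  -- Precomposing with a transposition of the first `a + 1` indices fixes the later sets.
  have hfix : ∀ (π : Equiv.Perm (Fin n)) (j : Fin n), j ∈ J → ∀ b, a + 1 ≤ b →
      prefixSet (π * Equiv.swap j ⟨a, ha⟩) b = prefixSet π b := by
    intro π j hj b hb
    have hj' : (j : ℕ) < a + 1 := by simpa [J] using hj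
    ext i
    rw [mem_prefixSet, mem_prefixSet]
    have : (π * Equiv.swap j ⟨a, ha⟩).symm i = Equiv.swap j ⟨a, ha⟩ (π.symm i) := by
      rw [Equiv.symm_apply_eq]; simp
    rw [this]
    by_cases h1 : π.symm i = j
    · rw [h1, Equiv.swap_apply_left]; simp only; omega
    · by_cases h2 : π.symm i = ⟨a, ha⟩
      · rw [h2, Equiv.swap_apply_right]; simp only; omega
      · rw [Equiv.swap_apply_of_ne_of_ne h1 h2]
  have herase : ∀ (π : Equiv.Perm (Fin n)) (j : Fin n), j ∈ J →
      prefixSet (π * Equiv.swap j ⟨a, ha⟩) a = (prefixSet π (a + 1)).erase (π j) := by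
    intro π j hj
    rw [← hfix π j hj (a + 1) le_rfl]
    ext i
    rw [mem_erase, mem_prefixSet, mem_prefixSet]
    set ρ := π * Equiv.swap j ⟨a, ha⟩ with hρ
    have h1 : π j = ρ ⟨a, ha⟩ := by simp [hρ]
    rw [h1, Ne, ← Equiv.symm_apply_eq, Fin.ext_iff]
    simp only; omega
  have hj : ∀ j ∈ J, 𝔼 π : Equiv.Perm (Fin n), f (prefixSet π a) * G (prefixSet π m) =
      𝔼 π : Equiv.Perm (Fin n), f ((prefixSet π (a + 1)).erase (π j)) * G (prefixSet π m) := by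
    intro j hj
    symm
    refine Fintype.expect_equiv (Equiv.mulRight (Equiv.swap j ⟨a, ha⟩)) _ _ fun π => ?_
    rw [Equiv.coe_mulRight, herase π j hj, hfix π j hj m hm]
  have hsum := sum_congr (rfl : J = J) hj
  rw [sum_const, nsmul_eq_mul, hJ, ← expect_sum_comm] at hsum
  have hshadow : ∀ π : Equiv.Perm (Fin n), shadowSum f (prefixSet π (a + 1)) =
      ∑ j ∈ J, f ((prefixSet π (a + 1)).erase (π j)) := by
    intro π
    rw [shadowSum]
    conv_lhs => rw [prefixSet_eq_map]
    rw [sum_map]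
    refine sum_congr rfl fun j _ => ?_
    rw [prefixSet_eq_map]; rfl
  have hpos : (0 : ℝ) < (a : ℝ) + 1 := by positivity
  rw [eq_div_of_mul_eq hpos.ne' ((mul_comm _ _).trans hsum), expect_div]
  refine expect_congr rfl fun π _ => ?_
  rw [← sum_mul, hshadow, div_mul_eq_mul_div]

/-! ### Conditional expectations along the chain -/

theorem shadowSum_ev (c : Finset (Fin n) → ℝ) (y : Finset (Fin n)) :
    shadowSum (ev c) y = ev (fun S => ((y.card : ℝ) - S.card) * c S) y := by
  have h : ∀ i ∈ y, ev c (y.erase i) = ∑ S ∈ y.powerset, if i ∉ S then c S else 0 := by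
    intro i hi
    rw [ev, ← sum_filter]
    refine sum_congr ?_ fun _ _ => rfl
    ext S; simp [subset_erase]
  rw [shadowSum, sum_congr rfl h, sum_comm, ev]
  refine sum_congr rfl fun S hS => ?_
  have hS' := mem_powerset.1 hS
  rw [← sum_filter, sum_const, nsmul_eq_mul]
  have : (y.filter fun i => i ∉ S) = y \ S := by ext; simp
  rw [this, card_sdiff_of_subset hS', Nat.cast_sub (card_le_card hS')]

/-- The coefficients of the conditional expectation given `X(b)` of a polynomial in `X(a)`, where
`a ≤ b`: a monomial of degree `s` survives with probability `a(a-1)⋯(a-s+1) / b(b-1)⋯(b-s+1)`. -/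
noncomputable def rescale (a b : ℕ) (c : Finset (Fin n) → ℝ) (S : Finset (Fin n)) : ℝ :=
  c S * (a.descFactorial S.card / b.descFactorial S.card)

theorem ev_congr {c c' : Finset (Fin n) → ℝ} {x : Finset (Fin n)}
    (h : ∀ S, S.card ≤ x.card → c S = c' S) : ev c x = ev c' x :=
  sum_congr rfl fun S hS => h S (card_le_card (mem_powerset.1 hS))

theorem ev_rescale_self (a : ℕ) (c : Finset (Fin n) → ℝ) {x : Finset (Fin n)} (hx : x.card = a) :
    ev (rescale a a c) x = ev c x := by
  refine ev_congr fun S hS => ?_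
  have : (a.descFactorial S.card : ℝ) ≠ 0 := by
    have := Nat.descFactorial_eq_zero_iff_lt.not.2 (not_lt.2 (hx ▸ hS))
    exact_mod_cast this
  rw [rescale, div_self this, mul_one]

theorem shadowSum_ev_rescale {a b : ℕ} (hab : a ≤ b) (c : Finset (Fin n) → ℝ)
    {y : Finset (Fin n)} (hy : y.card = b + 1) :
    shadowSum (ev (rescale a b c)) y / (b + 1) = ev (rescale a (b + 1) c) y := by
  rw [shadowSum_ev, ev, sum_div]
  refine sum_congr rfl fun S hS => ?_
  have hS' : S.card ≤ b + 1 := hy ▸ card_le_card (mem_powerset.1 hS)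
  rw [rescale, rescale, hy]
  have hb : (b : ℝ) + 1 ≠ 0 := by positivity
  rcases hS'.lt_or_eq with h | h
  · have h1 : (b.descFactorial S.card : ℝ) ≠ 0 := by
      have := Nat.descFactorial_eq_zero_iff_lt.not.2 (not_lt.2 (Nat.lt_succ_iff.1 h))
      exact_mod_cast this
    have h2 : ((b + 1).descFactorial S.card : ℝ) ≠ 0 := by
      have := Nat.descFactorial_eq_zero_iff_lt.not.2 (not_lt.2 hS')
      exact_mod_cast this
    have h3 : ((b : ℝ) + 1 - S.card) * (b + 1).descFactorial S.card =
        (b + 1) * b.descFactorial S.card := by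
      have := Nat.succ_descFactorial b S.card
      have h4 : ((b + 1 - S.card : ℕ) : ℝ) = b + 1 - S.card := by
        rw [Nat.cast_sub hS']; push_cast; rfl
      rw [← h4]; exact_mod_cast this
    push_cast
    field_simp
    linear_combination (c S) * (a.descFactorial S.card : ℝ) * h3
  -- Here the denominator of `rescale a b c S` vanishes, but so does its numerator.
  · have h1 : a.descFactorial S.card = 0 := Nat.descFactorial_eq_zero_iff_lt.2 (by omega)
    simp [h1]

/-- `ev (rescale a m c)` evaluated at `X(m)` is the conditional expectation of `ev c` at `X(a)`,
given `X(m)`. -/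
theorem expect_ev_mul_eq_rescale {a m : ℕ} (ham : a ≤ m) (hm : m ≤ n)
    (c G : Finset (Fin n) → ℝ) :
    𝔼 π : Equiv.Perm (Fin n), ev c (prefixSet π a) * G (prefixSet π m) =
      𝔼 π : Equiv.Perm (Fin n), ev (rescale a m c) (prefixSet π m) * G (prefixSet π m) := by
  suffices h : ∀ b, a ≤ b → b ≤ m →
      𝔼 π : Equiv.Perm (Fin n), ev c (prefixSet π a) * G (prefixSet π m) =
      𝔼 π : Equiv.Perm (Fin n), ev (rescale a b c) (prefixSet π b) * G (prefixSet π m) from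
    h m ham le_rfl
  intro b hab
  induction b, hab using Nat.le_induction with
  | base =>
    intro _
    exact expect_congr rfl fun π _ => by rw [ev_rescale_self a c (card_prefixSet π (by omega))]
  | succ b hab ih =>
    intro hb
    rw [ih (by omega), expect_prefixSet_step (by omega) _ hb]
    exact expect_congr rfl fun π _ => by
      rw [shadowSum_ev_rescale hab c (card_prefixSet π (by omega))]

theorem expect_sq_sub_rescale {a m : ℕ} (ham : a ≤ m) (hm : m ≤ n) (c : Finset (Fin n) → ℝ) :
    𝔼 π : Equiv.Perm (Fin n), (ev c (prefixSet π a) - ev (rescale a m c) (prefixSet π m)) ^ 2 =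
      (𝔼 π : Equiv.Perm (Fin n), ev c (prefixSet π a) ^ 2) -
        𝔼 π : Equiv.Perm (Fin n), ev (rescale a m c) (prefixSet π m) ^ 2 := by
  have h := expect_ev_mul_eq_rescale ham hm c (ev (rescale a m c))
  have h2 : ∀ π : Equiv.Perm (Fin n),
      (ev c (prefixSet π a) - ev (rescale a m c) (prefixSet π m)) ^ 2 =
      ev c (prefixSet π a) ^ 2 -
        2 * (ev c (prefixSet π a) * ev (rescale a m c) (prefixSet π m)) +
        ev (rescale a m c) (prefixSet π m) ^ 2 := fun π => by ring
  simp_rw [h2]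
  rw [expect_add_distrib, expect_sub_distrib, ← mul_expect, h]
  simp_rw [← sq]
  ring

theorem expect_sq_rescale_le {a m : ℕ} (ham : a ≤ m) (hm : m ≤ n) (c : Finset (Fin n) → ℝ) :
    𝔼 π : Equiv.Perm (Fin n), ev (rescale a m c) (prefixSet π m) ^ 2 ≤
      𝔼 π : Equiv.Perm (Fin n), ev c (prefixSet π a) ^ 2 := by
  rw [← sub_nonneg, ← expect_sq_sub_rescale ham hm]
  exact expect_nonneg fun _ _ => sq_nonneg _

/-- A step of the chain loses at most a fraction `d (n + 1) / ((b + 1) (n - b))` of the norm. -/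
theorem expect_sq_shadowSum_ge {d b : ℕ} (hb : b < n) (c : Finset (Fin n) → ℝ)
    (hc : ∀ S, d < S.card → c S = 0) :
    (1 - d * (n + 1) / ((b + 1) * (n - b))) *
        𝔼 π : Equiv.Perm (Fin n), ev c (prefixSet π b) ^ 2 ≤
      𝔼 π : Equiv.Perm (Fin n), (shadowSum (ev c) (prefixSet π (b + 1)) / (b + 1)) ^ 2 := by
  let g : Finset (Fin n) → ℝ := fun x => if x.card = b then ev c x else 0
  have hen := shadowSum_energy c d b hc g fun _ => rfl
  have hl : ∑ x, g x ^ 2 = ∑ x ∈ powersetCard b univ, ev c x ^ 2 := by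
    simp only [g, ite_pow, zero_pow two_ne_zero, ← sum_filter]
    refine sum_congr ?_ fun _ _ => rfl
    ext; simp
  have hr : ∑ y, shadowSum g y ^ 2 = ∑ y ∈ powersetCard (b + 1) univ, shadowSum (ev c) y ^ 2 := by
    rw [← sum_subset (subset_univ (powersetCard (b + 1) (univ : Finset (Fin n))))]
    · refine sum_congr rfl fun y hy => ?_
      congr 1
      refine sum_congr rfl fun i hi => if_pos ?_
      rw [card_erase_of_mem hi, (mem_powersetCard.1 hy).2]; rfl
    · intro y _ hy
      rw [sq_eq_zero_iff]
      refine sum_eq_zero fun i hi => if_neg fun h => hy ?_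
      rw [card_erase_of_mem hi] at h
      have := card_pos.2 ⟨i, hi⟩
      simp; omega
  rw [hl, hr] at hen
  have hcast : (0 : ℝ) < n - b := by have : (b : ℝ) < n := by exact_mod_cast hb
                                     linarith
  have hch : (n.choose (b + 1) : ℝ) * (b + 1) = n.choose b * (n - b) := by
    have := Nat.choose_succ_right_eq n b
    rw [← Nat.cast_sub hb.le]; exact_mod_cast this
  have hc1 : (0 : ℝ) < n.choose b := by exact_mod_cast Nat.choose_pos hb.le
  have hc2 : (0 : ℝ) < n.choose (b + 1) := by exact_mod_cast Nat.choose_pos hb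
  have hb1 : (0 : ℝ) < (b : ℝ) + 1 := by positivity
  rw [expect_prefixSet (fun x => ev c x ^ 2) hb.le,
    expect_prefixSet (fun x => (shadowSum (ev c) x / (b + 1)) ^ 2) hb]
  simp_rw [div_pow]
  rw [← sum_div]
  set A := ∑ x ∈ powersetCard b univ, ev c x ^ 2
  set B := ∑ y ∈ powersetCard (b + 1) univ, shadowSum (ev c) y ^ 2
  have e1 : (1 - d * (n + 1) / (((b : ℝ) + 1) * (n - b))) * (A / n.choose b) =
      ((((b : ℝ) + 1) * (n - b) - d * (n + 1)) * A) / (n.choose b * (n - b) * (b + 1)) := by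
    field_simp
  have e2 : B / ((b : ℝ) + 1) ^ 2 / n.choose (b + 1) = B / (n.choose b * (n - b) * (b + 1)) := by
    rw [← hch]; field_simp
  rw [e1, e2]
  gcongr

/-- A polynomial of degree `d` in `X(a)` is nearly determined by a later set `X(m)` of the chain:
the conditional variance is at most `(m - a) θ`, where `θ` bounds the loss in a single step. -/
theorem expect_sq_sub_rescale_le {d a m : ℕ} (ham : a ≤ m) (hm : m ≤ n)
    (c : Finset (Fin n) → ℝ) (hc : ∀ S, d < S.card → c S = 0) {θ : ℝ}
    (hθ : ∀ b, a ≤ b → b < m → d * (n + 1) / (((b : ℝ) + 1) * (n - b)) ≤ θ) :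
    (𝔼 π : Equiv.Perm (Fin n), ev c (prefixSet π a) ^ 2) -
        𝔼 π : Equiv.Perm (Fin n), ev (rescale a m c) (prefixSet π m) ^ 2 ≤
      ((m : ℝ) - a) * θ * 𝔼 π : Equiv.Perm (Fin n), ev c (prefixSet π a) ^ 2 := by
  set e : ℕ → ℝ := fun b => 𝔼 π : Equiv.Perm (Fin n), ev (rescale a b c) (prefixSet π b) ^ 2
    with he
  set e₀ : ℝ := 𝔼 π : Equiv.Perm (Fin n), ev c (prefixSet π a) ^ 2 with he₀
  suffices h : ∀ b, a ≤ b → b ≤ m → e₀ - e b ≤ ((b : ℝ) - a) * θ * e₀ from h m ham le_rfl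
  intro b hab
  induction b, hab using Nat.le_induction with
  | base =>
    intro _
    have : e a = e₀ := expect_congr rfl fun π _ => by
      rw [ev_rescale_self a c (card_prefixSet π (by omega))]
    simp [this]
  | succ b hab ih =>
    intro hb
    have h1 := ih (by omega)
    have h2 := expect_sq_shadowSum_ge (d := d) (b := b) (by omega) (rescale a b c)
      (fun S hS => by simp [rescale, hc S hS])
    have h3 : 𝔼 π : Equiv.Perm (Fin n),
        (shadowSum (ev (rescale a b c)) (prefixSet π (b + 1)) / (b + 1)) ^ 2 = e (b + 1) :=
      expect_congr rfl fun π _ => by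
        rw [shadowSum_ev_rescale hab c (card_prefixSet π (by omega))]
    rw [h3] at h2
    have h4 : e b ≤ e₀ := expect_sq_rescale_le hab (by omega) c
    have h5 : 0 ≤ e b := expect_nonneg fun _ _ => sq_nonneg _
    have h6 := hθ b hab (by omega)
    have hbn : (b : ℝ) < n := by exact_mod_cast (by omega : b < n)
    have h7 : 0 ≤ d * (n + 1) / (((b : ℝ) + 1) * (n - b)) :=
      div_nonneg (by positivity) (mul_nonneg (by positivity) (by linarith))
    change (1 - d * (n + 1) / (((b : ℝ) + 1) * (n - b))) * e b ≤ e (b + 1) at h2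
    push_cast
    have h8 : d * (n + 1) / (((b : ℝ) + 1) * (n - b)) * e b ≤ θ * e₀ :=
      mul_le_mul h6 h4 h5 (h7.trans h6)
    linarith

end Chain

section Interpolation

/-! ### Interpolation weights -/

section Weights

variable {n d : ℕ} {p : ℝ} {k : Fin (d + 1) → ℕ}

/-- The weights reproduce polynomials of degree at most `d`. -/
theorem sum_weight_mul_eval (hk : Function.Injective fun j => stdLevel n p (k j)) (t : ℝ)
    (P : Polynomial ℝ) (hP : P.natDegree ≤ d) :
    ∑ i, weight n p k t i * P.eval (stdLevel n p (k i)) = P.eval t := by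
  set V := Matrix.vandermonde fun j => stdLevel n p (k j) with hV
  have hdet : IsUnit V.det := by
    rw [isUnit_iff_ne_zero]; exact Matrix.det_vandermonde_ne_zero_iff.2 hk
  have hinv : V⁻¹ * V = 1 := Matrix.nonsing_inv_mul V hdet
  have hev : ∀ x, P.eval x = ∑ e : Fin (d + 1), P.coeff e * x ^ (e : ℕ) := by
    intro x
    rw [Polynomial.eval_eq_sum_range' (Nat.lt_succ_of_le hP), Finset.sum_range]
  have h1 : ∀ i, weight n p k t i * P.eval (stdLevel n p (k i)) =
      ∑ e : Fin (d + 1), ∑ e' : Fin (d + 1),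
        t ^ (e : ℕ) * P.coeff e' * (V⁻¹ e i * V i e') := by
    intro i
    rw [weight, hev, sum_mul_sum]
    refine sum_congr rfl fun e _ => sum_congr rfl fun e' _ => ?_
    rw [← hV, show V i e' = stdLevel n p (k i) ^ (e' : ℕ) from rfl]
    ring
  simp_rw [h1]
  rw [sum_comm]
  have h2 : ∀ e : Fin (d + 1), ∑ i, ∑ e' : Fin (d + 1),
      t ^ (e : ℕ) * P.coeff e' * (V⁻¹ e i * V i e') = P.coeff e * t ^ (e : ℕ) := by
    intro e
    rw [sum_comm]
    simp_rw [← mul_sum, ← Matrix.mul_apply, hinv, Matrix.one_apply]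
    simp [mul_comm]
  simp_rw [h2]
  exact (hev t).symm

/-- The weights are the Lagrange basis polynomials of the nodes `σ_i`. -/
theorem weight_eq_prod (hk : Function.Injective fun j => stdLevel n p (k j)) (t : ℝ)
    (i : Fin (d + 1)) :
    weight n p k t i = ∏ j ∈ univ.erase i,
      (stdLevel n p (k i) - stdLevel n p (k j))⁻¹ * (t - stdLevel n p (k j)) := by
  set σ : Fin (d + 1) → ℝ := fun j => stdLevel n p (k j) with hσ
  have hdeg : (Lagrange.basis univ σ i).natDegree ≤ d := by
    rw [Lagrange.natDegree_basis hk.injOn (mem_univ i)]; simp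
  have h := sum_weight_mul_eval hk t _ hdeg
  rw [sum_eq_single i (fun j _ hj => by
    rw [Lagrange.eval_basis_of_ne (v := σ) hj.symm (mem_univ j), mul_zero]) (by simp),
    Lagrange.eval_basis_self (v := σ) hk.injOn (mem_univ i), mul_one] at h
  rw [h, Lagrange.basis, Polynomial.eval_prod]
  simp [Lagrange.basisDivisor, hσ]

theorem IsSystem.injective {η M : ℝ} (h : IsSystem n p η M k) :
    Function.Injective fun j => stdLevel n p (k j) := by
  intro i j hij
  by_contra hne
  have h1 := h.separated i j hne
  have h2 : stdLevel n p (k i) = stdLevel n p (k j) := hij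
  rw [h2, sub_self, abs_zero] at h1
  exact absurd h.eta_pos (not_lt.2 h1)

theorem IsSystem.abs_weight_le {η M : ℝ} (h : IsSystem n p η M k) (t : ℝ) (i : Fin (d + 1)) :
    |weight n p k t i| ≤ ((1 + |t|) * (M / η)) ^ d := by
  have hη := h.eta_pos
  have hM := h.one_le_M
  rw [weight_eq_prod h.injective, abs_prod]
  have hcard : (univ.erase i : Finset (Fin (d + 1))).card = d := by simp
  refine (prod_le_prod (fun _ _ => abs_nonneg _) fun j hj => ?_).trans_eq
    ((prod_const _).trans (by rw [hcard]))
  have h1 := h.separated i j (ne_of_mem_erase hj).symm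
  have h2 : |t - stdLevel n p (k j)| ≤ (1 + |t|) * M := by
    have := abs_sub t (stdLevel n p (k j))
    have := h.bounded j
    nlinarith [abs_nonneg t]
  rw [abs_mul, abs_inv, mul_div_assoc', div_eq_inv_mul]
  exact mul_le_mul (inv_anti₀ hη h1) h2 (abs_nonneg _) (inv_nonneg.2 hη.le)

theorem eval_stdLevel_affine (hN : 0 < binVar n p) (P : Polynomial ℝ) (u v : ℝ) (l : ℕ) :
    (P.comp (Polynomial.C (u + v * (n * p)) +
      Polynomial.C (v * Real.sqrt (binVar n p)) * Polynomial.X)).eval (stdLevel n p l) =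
      P.eval (u + v * l) := by
  have : Real.sqrt (binVar n p) ≠ 0 := (Real.sqrt_pos.2 hN).ne'
  simp only [Polynomial.eval_comp, Polynomial.eval_add, Polynomial.eval_C, Polynomial.eval_mul,
    Polynomial.eval_X, stdLevel]
  congr 1
  field_simp
  ring

theorem sum_weight_mul_eval_affine (hN : 0 < binVar n p)
    (hk : Function.Injective fun j => stdLevel n p (k j)) (P : Polynomial ℝ)
    (hP : P.natDegree ≤ d) (u v : ℝ) (l : ℕ) :
    ∑ i, weight n p k (stdLevel n p l) i * P.eval (u + v * k i) = P.eval (u + v * l) := by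
  have hdeg : (P.comp (Polynomial.C (u + v * (n * p)) +
      Polynomial.C (v * Real.sqrt (binVar n p)) * Polynomial.X)).natDegree ≤ d := by
    refine Polynomial.natDegree_comp_le.trans ((Nat.mul_le_mul hP ?_).trans_eq (mul_one d))
    compute_degree
  have := sum_weight_mul_eval hk (stdLevel n p l) _ hdeg
  simpa only [eval_stdLevel_affine hN] using this

/-- The weights interpolate the falling factorials, which are the coefficients that appear in
conditional expectations given a later set of the chain. -/
theorem sum_weight_mul_descFactorial (hN : 0 < binVar n p)
    (hk : Function.Injective fun j => stdLevel n p (k j)) {s : ℕ} (hs : s ≤ d) (l : ℕ) :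
    ∑ i, weight n p k (stdLevel n p l) i * (k i).descFactorial s = l.descFactorial s := by
  have := sum_weight_mul_eval_affine hN hk (descPochhammer ℝ s)
    (by rwa [descPochhammer_natDegree]) 0 1 l
  simpa [descPochhammer_eval_eq_descFactorial] using this

/-- The analogue for complements, used to condition on an earlier set of the chain. -/
theorem sum_weight_mul_descFactorial_sub (hN : 0 < binVar n p)
    (hk : Function.Injective fun j => stdLevel n p (k j)) (hkn : ∀ i, k i ≤ n)
    {s : ℕ} (hs : s ≤ d) {l : ℕ} (hl : l ≤ n) :
    ∑ i, weight n p k (stdLevel n p l) i * (n - k i).descFactorial s =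
      (n - l).descFactorial s := by
  have h := sum_weight_mul_eval_affine hN hk (descPochhammer ℝ s)
    (by rwa [descPochhammer_natDegree]) n (-1) l
  have e : ∀ a : ℕ, a ≤ n → (n : ℝ) + -1 * a = ((n - a : ℕ) : ℝ) := by
    intro a ha; rw [Nat.cast_sub ha]; ring
  rw [e l hl] at h
  simp_rw [fun i => e (k i) (hkn i)] at h
  simpa only [descPochhammer_eval_eq_descFactorial] using h

end Weights

/-! ### Extrapolation between slices -/

variable {n : ℕ}

/-- The triangle inequality in `L₂` for a combination of functions of norm at most one. -/
theorem expect_sq_sum_mul_le {Ω ι : Type*} [Fintype Ω] [Fintype ι] (w : ι → ℝ)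
    (G : ι → Ω → ℝ) (hG : ∀ i, 𝔼 ω, G i ω ^ 2 ≤ 1) :
    𝔼 ω, (∑ i, w i * G i ω) ^ 2 ≤ (∑ i, |w i|) ^ 2 := by
  have h : ∀ ω, (∑ i, w i * G i ω) ^ 2 ≤ (∑ i, |w i|) * ∑ i, |w i| * G i ω ^ 2 := by
    intro ω
    refine sum_sq_le_sum_mul_sum_of_sq_le_mul univ (fun _ _ => abs_nonneg _)
      (fun _ _ => by positivity) fun i _ => ?_
    exact le_of_eq (by rw [mul_pow, ← sq_abs (w i)]; ring)
  refine (expect_le_expect fun ω _ => h ω).trans ?_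
  rw [← mul_expect, expect_sum_comm, sq]
  refine mul_le_mul_of_nonneg_left (sum_le_sum fun i _ => ?_)
    (sum_nonneg fun _ _ => abs_nonneg _)
  rw [← mul_expect]
  exact mul_le_of_le_one_right (abs_nonneg _) (hG i)

theorem expect_abs_le_of_sq_le {Ω : Type*} [Fintype Ω] [Nonempty Ω] (g : Ω → ℝ) {A : ℝ}
    (hA : 0 ≤ A) (h : 𝔼 ω, g ω ^ 2 ≤ A ^ 2) : 𝔼 ω, |g ω| ≤ A := by
  refine abs_le_of_sq_le_sq' ?_ hA |>.2
  refine le_trans ?_ h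
  have hvar : 0 ≤ 𝔼 ω, (|g ω| - 𝔼 ω, |g ω|) ^ 2 := expect_nonneg fun _ _ => sq_nonneg _
  set m := 𝔼 ω, |g ω| with hm
  have h2 : ∀ ω, (|g ω| - m) ^ 2 = g ω ^ 2 - 2 * m * |g ω| + m ^ 2 := fun ω => by
    rw [← sq_abs (g ω)]; ring
  simp_rw [h2] at hvar
  rw [expect_add_distrib, expect_sub_distrib, ← mul_expect, Fintype.expect_const, ← hm] at hvar
  linarith

theorem ev_rescale_eq_sum {ι : Type*} [Fintype ι] {d : ℕ} {c : Finset (Fin n) → ℝ}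
    (hc : ∀ S, d < S.card → c S = 0) {k : ι → ℕ} {l : ℕ} {w : ι → ℝ}
    (hw : ∀ s ≤ d, ∑ i, w i * (k i).descFactorial s = l.descFactorial s) (m : ℕ)
    (x : Finset (Fin n)) :
    ev (rescale l m c) x = ∑ i, w i * ev (rescale (k i) m c) x := by
  simp_rw [ev, mul_sum]
  rw [sum_comm]
  refine sum_congr rfl fun S _ => ?_
  by_cases hS : d < S.card
  · simp [rescale, hc S hS]
  · rw [rescale, ← hw S.card (by omega), sum_div, mul_sum]
    refine sum_congr rfl fun i _ => ?_
    rw [rescale]; ring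

/-- Conditionally on a set of the chain later than all the levels, interpolation is exact. -/
theorem expect_sq_rescale_le_of_weights {ι : Type*} [Fintype ι] {d : ℕ}
    {c : Finset (Fin n) → ℝ} (hc : ∀ S, d < S.card → c S = 0) {k : ι → ℕ} {l m : ℕ} {w : ι → ℝ}
    (hw : ∀ s ≤ d, ∑ i, w i * (k i).descFactorial s = l.descFactorial s)
    (hkm : ∀ i, k i ≤ m) (hm : m ≤ n)
    (hk1 : ∀ i, 𝔼 π : Equiv.Perm (Fin n), ev c (prefixSet π (k i)) ^ 2 ≤ 1) :
    𝔼 π : Equiv.Perm (Fin n), ev (rescale l m c) (prefixSet π m) ^ 2 ≤ (∑ i, |w i|) ^ 2 := by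
  simp_rw [ev_rescale_eq_sum hc hw]
  exact expect_sq_sum_mul_le w
    (fun i (π : Equiv.Perm (Fin n)) => ev (rescale (k i) m c) (prefixSet π m))
    fun i => (expect_sq_rescale_le (hkm i) hm c).trans (hk1 i)

/-- Extrapolation to a level above all the levels of the system. -/
theorem expect_sq_le_of_ge {ι : Type*} [Fintype ι] {d : ℕ}
    {c : Finset (Fin n) → ℝ} (hc : ∀ S, d < S.card → c S = 0) {k : ι → ℕ} {l : ℕ} {w : ι → ℝ}
    (hw : ∀ s ≤ d, ∑ i, w i * (k i).descFactorial s = l.descFactorial s)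
    (hkl : ∀ i, k i ≤ l) (hl : l ≤ n)
    (hk1 : ∀ i, 𝔼 π : Equiv.Perm (Fin n), ev c (prefixSet π (k i)) ^ 2 ≤ 1) :
    𝔼 π : Equiv.Perm (Fin n), ev c (prefixSet π l) ^ 2 ≤ (∑ i, |w i|) ^ 2 := by
  refine le_trans (le_of_eq ?_) (expect_sq_rescale_le_of_weights hc hw hkl hl hk1)
  exact expect_congr rfl fun π _ => by rw [ev_rescale_self l c (card_prefixSet π hl)]

/-- Complementing all coordinates preserves the degree. -/
theorem exists_ev_compl {d : ℕ} {c : Finset (Fin n) → ℝ} (hc : ∀ S, d < S.card → c S = 0) :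
    ∃ c' : Finset (Fin n) → ℝ, (∀ S, d < S.card → c' S = 0) ∧ ∀ x, ev c' x = ev c xᶜ := by
  refine ⟨fun R => ∑ S, if R ⊆ S then (-1) ^ R.card * c S else 0, ?_, ?_⟩
  · intro R hR
    refine sum_eq_zero fun S _ => ?_
    split_ifs with h
    · rw [hc S (hR.trans_le (card_le_card h)), mul_zero]
    · rfl
  · intro x
    rw [ev, sum_comm, ev_eq]
    refine sum_congr rfl fun S _ => ?_
    have h1 : ∑ R ∈ x.powerset, (if R ⊆ S then (-1 : ℝ) ^ R.card * c S else 0) =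
        ((∑ R ∈ (x ∩ S).powerset, (-1 : ℤ) ^ R.card : ℤ) : ℝ) * c S := by
      rw [← sum_filter, Int.cast_sum, sum_mul]
      refine sum_congr ?_ fun R _ => by push_cast; rfl
      ext R; rw [mem_filter, mem_powerset, mem_powerset, subset_inter_iff]
    rw [h1, sum_powerset_neg_one_pow_card]
    have h2 : x ∩ S = ∅ ↔ S ⊆ xᶜ := by
      rw [← disjoint_iff_inter_eq_empty, disjoint_comm, subset_compl_iff_disjoint_right]
    simp only [h2]
    split_ifs <;> simp

/-- The complement of the chain, run backwards, is again the chain. -/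
theorem expect_prefixSet_compl (g : Finset (Fin n) → ℝ) {k : ℕ} (hk : k ≤ n) :
    𝔼 π : Equiv.Perm (Fin n), g (prefixSet π (n - k))ᶜ =
      𝔼 π : Equiv.Perm (Fin n), g (prefixSet π k) := by
  refine Fintype.expect_equiv (Equiv.mulRight Fin.revPerm) _ _ fun π => ?_
  congr 1
  ext i
  rw [mem_compl, mem_prefixSet, mem_prefixSet, Equiv.coe_mulRight]
  have : (π * Fin.revPerm).symm i = Fin.rev (π.symm i) := by
    rw [Equiv.symm_apply_eq]; simp
  rw [this, Fin.val_rev]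
  have := (π.symm i).isLt
  omega

/-- Extrapolation to a level below all the levels of the system. -/
theorem expect_sq_le_of_le {ι : Type*} [Fintype ι] {d : ℕ}
    {c : Finset (Fin n) → ℝ} (hc : ∀ S, d < S.card → c S = 0) {k : ι → ℕ} {l : ℕ} {w : ι → ℝ}
    (hw : ∀ s ≤ d, ∑ i, w i * (n - k i).descFactorial s = (n - l).descFactorial s)
    (hkl : ∀ i, l ≤ k i) (hkn : ∀ i, k i ≤ n) (hl : l ≤ n)
    (hk1 : ∀ i, 𝔼 π : Equiv.Perm (Fin n), ev c (prefixSet π (k i)) ^ 2 ≤ 1) :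
    𝔼 π : Equiv.Perm (Fin n), ev c (prefixSet π l) ^ 2 ≤ (∑ i, |w i|) ^ 2 := by
  obtain ⟨c', hc', hcc⟩ := exists_ev_compl hc
  have h : ∀ a ≤ n, 𝔼 π : Equiv.Perm (Fin n), ev c' (prefixSet π (n - a)) ^ 2 =
      𝔼 π : Equiv.Perm (Fin n), ev c (prefixSet π a) ^ 2 := by
    intro a ha
    simp_rw [hcc]
    exact expect_prefixSet_compl (fun x => ev c x ^ 2) ha
  rw [← h l hl]
  exact expect_sq_le_of_ge hc' hw (fun i => by have := hkl i; omega) (by omega)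
    fun i => (h (k i) (hkn i)).trans_le (hk1 i)

/-- Interpolation of norms to a level `l` so close to `m` that conditioning on `X(m)` loses at most
half of the squared norm. -/
theorem expect_sq_le_of_near {ι : Type*} [Fintype ι] {d : ℕ}
    {c : Finset (Fin n) → ℝ} (hc : ∀ S, d < S.card → c S = 0) {k : ι → ℕ} {l m : ℕ} {w : ι → ℝ}
    (hw : ∀ s ≤ d, ∑ i, w i * (k i).descFactorial s = l.descFactorial s)
    (hkm : ∀ i, k i ≤ m) (hlm : l ≤ m) (hm : m ≤ n)
    (hk1 : ∀ i, 𝔼 π : Equiv.Perm (Fin n), ev c (prefixSet π (k i)) ^ 2 ≤ 1) {θ : ℝ}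
    (hθ : ∀ b, l ≤ b → b < m → d * (n + 1) / (((b : ℝ) + 1) * (n - b)) ≤ θ)
    (hmθ : ((m : ℝ) - l) * θ ≤ 1 / 2) :
    𝔼 π : Equiv.Perm (Fin n), ev c (prefixSet π l) ^ 2 ≤ 2 * (∑ i, |w i|) ^ 2 := by
  have h1 := expect_sq_rescale_le_of_weights hc hw hkm hm hk1
  have h2 := expect_sq_sub_rescale_le hlm hm c hc hθ
  have h3 : 0 ≤ 𝔼 π : Equiv.Perm (Fin n), ev c (prefixSet π l) ^ 2 :=
    expect_nonneg fun _ _ => sq_nonneg _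
  nlinarith

/-- The interpolation error along the chain, in `L₁`. -/
theorem expect_abs_sub_interpolation_le {ι : Type*} [Fintype ι] {d : ℕ}
    {c : Finset (Fin n) → ℝ} (hc : ∀ S, d < S.card → c S = 0) {k : ι → ℕ} {l m : ℕ} {w : ι → ℝ}
    (hw : ∀ s ≤ d, ∑ i, w i * (k i).descFactorial s = l.descFactorial s)
    (hkm : ∀ i, k i ≤ m) (hlm : l ≤ m) (hm : m ≤ n)
    (hk1 : ∀ i, 𝔼 π : Equiv.Perm (Fin n), ev c (prefixSet π (k i)) ^ 2 ≤ 1) {θ δ Λ : ℝ}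
    (hθ : ∀ b, (l ≤ b ∨ ∃ i, k i ≤ b) → b < m → d * (n + 1) / (((b : ℝ) + 1) * (n - b)) ≤ θ)
    (hδ : 0 ≤ δ) (hlδ : ((m : ℝ) - l) * θ ≤ δ ^ 2) (hkδ : ∀ i, ((m : ℝ) - k i) * θ ≤ δ ^ 2)
    (hΛ : 0 ≤ Λ) (hl : 𝔼 π : Equiv.Perm (Fin n), ev c (prefixSet π l) ^ 2 ≤ Λ ^ 2) :
    𝔼 π : Equiv.Perm (Fin n),
      |ev c (prefixSet π l) - ∑ i, w i * ev c (prefixSet π (k i))| ≤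
        δ * (Λ + ∑ i, |w i|) := by
  -- The error of replacing `f(X(a))` by its conditional expectation given `X(m)`.
  let D : ℕ → Equiv.Perm (Fin n) → ℝ := fun a π =>
    ev c (prefixSet π a) - ev (rescale a m c) (prefixSet π m)
  have hD : ∀ a, a ≤ m → (∀ b, a ≤ b → b < m → d * (n + 1) / (((b : ℝ) + 1) * (n - b)) ≤ θ) →
      ((m : ℝ) - a) * θ ≤ δ ^ 2 → ∀ L : ℝ, 0 ≤ L →
      𝔼 π : Equiv.Perm (Fin n), ev c (prefixSet π a) ^ 2 ≤ L ^ 2 → 𝔼 π, |D a π| ≤ δ * L := by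
    intro a ham hb ha L hL haL
    refine expect_abs_le_of_sq_le _ (mul_nonneg hδ hL) ?_
    rw [expect_sq_sub_rescale ham hm, mul_pow]
    refine (expect_sq_sub_rescale_le ham hm c hc hb).trans
      (mul_le_mul ha haL (expect_nonneg fun _ _ => sq_nonneg _) (sq_nonneg _))
  have hpt : ∀ π : Equiv.Perm (Fin n),
      |ev c (prefixSet π l) - ∑ i, w i * ev c (prefixSet π (k i))| ≤
        |D l π| + ∑ i, |w i| * |D (k i) π| := by
    intro π
    have : ev c (prefixSet π l) - ∑ i, w i * ev c (prefixSet π (k i)) =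
        D l π - ∑ i, w i * D (k i) π := by
      simp only [D, mul_sub, sum_sub_distrib]
      rw [ev_rescale_eq_sum hc hw]; ring
    rw [this]
    refine (abs_sub _ _).trans (add_le_add_right ((abs_sum_le_sum_abs _ _).trans_eq ?_) _)
    exact sum_congr rfl fun i _ => abs_mul _ _
  refine (expect_le_expect fun π _ => hpt π).trans ?_
  rw [expect_add_distrib, expect_sum_comm, mul_add, mul_sum]
  refine add_le_add (hD l hlm (fun b hb => hθ b (Or.inl hb)) hlδ Λ hΛ hl)
    (sum_le_sum fun i _ => ?_)
  rw [← mul_expect, mul_comm δ]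
  refine mul_le_mul_of_nonneg_left ?_ (abs_nonneg _)
  have := hD (k i) (hkm i) (fun b hb => hθ b (Or.inr ⟨i, hb⟩)) (hkδ i) 1 zero_le_one
    ((hk1 i).trans_eq (one_pow 2).symm)
  rwa [mul_one] at this

end Interpolation

section Levels

/-! ### Moments and tails of the binomial distribution -/

/-- The probability that a binomial variable with parameters `n` and `p` equals `l`. -/
noncomputable def binWeight (n : ℕ) (p : ℝ) (l : ℕ) : ℝ := n.choose l * p ^ l * (1 - p) ^ (n - l)

variable {n : ℕ} {p : ℝ}

theorem binWeight_nonneg (hp0 : 0 ≤ p) (hp1 : p ≤ 1) (l : ℕ) : 0 ≤ binWeight n p l := by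
  have : 0 ≤ 1 - p := by linarith
  unfold binWeight; positivity

theorem sum_binWeight_mul_pow (x y : ℝ) :
    ∑ l ∈ Iic n, binWeight n p l * (x ^ l * y ^ (n - l)) = (p * x + (1 - p) * y) ^ n := by
  rw [add_pow, ← Nat.range_succ_eq_Iic]
  refine sum_congr rfl fun l _ => ?_
  rw [binWeight, mul_pow, mul_pow]; ring

theorem sum_binWeight : ∑ l ∈ Iic n, binWeight n p l = 1 := by
  have := sum_binWeight_mul_pow (n := n) (p := p) 1 1
  simpa using this

/-- Sub-Gaussian bound for the moment generating function, from `exp y ≤ 1 + y + y²`. -/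
theorem sum_binWeight_mul_exp_le (hp0 : 0 ≤ p) (hp1 : p ≤ 1) {t : ℝ} (ht : |t| ≤ 1) :
    ∑ l ∈ Iic n, binWeight n p l * Real.exp (t * (l - n * p)) ≤ Real.exp (t ^ 2 * binVar n p) := by
  have hq : 0 ≤ 1 - p := by linarith
  have h1 : ∀ l ∈ Iic n, binWeight n p l * Real.exp (t * (l - n * p)) =
      binWeight n p l * (Real.exp (t * (1 - p)) ^ l * Real.exp (-(t * p)) ^ (n - l)) := by
    intro l hl
    have hl' : l ≤ n := mem_Iic.1 hl
    rw [← Real.exp_nat_mul, ← Real.exp_nat_mul, ← Real.exp_add, Nat.cast_sub hl']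
    congr 2; ring
  rw [sum_congr rfl h1, sum_binWeight_mul_pow]
  have hexp : ∀ y : ℝ, |y| ≤ 1 → Real.exp y ≤ 1 + y + y ^ 2 := by
    intro y hy
    have := (abs_le.1 (Real.abs_exp_sub_one_sub_id_le hy)).2
    linarith
  have ha : |t * (1 - p)| ≤ 1 := by
    rw [abs_mul, abs_of_nonneg hq]; nlinarith [abs_nonneg t]
  have hb : |-(t * p)| ≤ 1 := by
    rw [abs_neg, abs_mul, abs_of_nonneg hp0]; nlinarith [abs_nonneg t]
  have h2 : p * Real.exp (t * (1 - p)) + (1 - p) * Real.exp (-(t * p)) ≤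
      Real.exp (t ^ 2 * (p * (1 - p))) := by
    have e1 := mul_le_mul_of_nonneg_left (hexp _ ha) hp0
    have e2 := mul_le_mul_of_nonneg_left (hexp _ hb) hq
    have e3 := Real.add_one_le_exp (t ^ 2 * (p * (1 - p)))
    nlinarith
  refine (pow_le_pow_left₀ (by positivity) h2 n).trans_eq ?_
  rw [← Real.exp_nat_mul, binVar]
  congr 1; ring

theorem sum_binWeight_mul_exp_stdLevel_le (hp0 : 0 ≤ p) (hp1 : p ≤ 1) (hN : 0 < binVar n p)
    {t : ℝ} (ht : |t| ≤ Real.sqrt (binVar n p)) :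
    ∑ l ∈ Iic n, binWeight n p l * Real.exp (t * stdLevel n p l) ≤ Real.exp (t ^ 2) := by
  have hs := Real.sqrt_pos.2 hN
  have h := sum_binWeight_mul_exp_le (n := n) hp0 hp1 (t := t / Real.sqrt (binVar n p))
    (by rw [abs_div, abs_of_pos hs]; exact div_le_one_of_le₀ ht hs.le)
  rw [div_pow, Real.sq_sqrt hN.le, div_mul_cancel₀ _ hN.ne'] at h
  refine le_trans (le_of_eq (sum_congr rfl fun l _ => ?_)) h
  rw [stdLevel]; congr 2; field_simp

theorem sum_binWeight_tail_le (hp0 : 0 ≤ p) (hp1 : p ≤ 1) (hN : 0 < binVar n p)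
    {s : ℝ} (hs0 : 0 ≤ s) (hs : s ≤ Real.sqrt (binVar n p)) :
    ∑ l ∈ (Iic n).filter (fun l => ¬ |stdLevel n p l| ≤ s), binWeight n p l ≤
      2 * Real.exp (-(s ^ 2 / 4)) := by
  have hb : |s / 2| ≤ Real.sqrt (binVar n p) := by
    rw [abs_of_nonneg (by positivity)]; linarith
  have h1 := sum_binWeight_mul_exp_stdLevel_le hp0 hp1 hN hb
  have h2 := sum_binWeight_mul_exp_stdLevel_le hp0 hp1 hN (t := -(s / 2)) (by rwa [abs_neg])
  have hpt : ∀ l ∈ (Iic n).filter (fun l => ¬ |stdLevel n p l| ≤ s), binWeight n p l ≤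
      Real.exp (-(s ^ 2 / 2)) * (binWeight n p l * Real.exp (s / 2 * stdLevel n p l) +
        binWeight n p l * Real.exp (-(s / 2) * stdLevel n p l)) := by
    intro l hl
    have hl' : s < |stdLevel n p l| := not_le.1 (mem_filter.1 hl).2
    rw [← mul_add, mul_left_comm]
    refine le_mul_of_one_le_right (binWeight_nonneg hp0 hp1 l) ?_
    rw [mul_add, ← Real.exp_add, ← Real.exp_add]
    rcases lt_abs.1 hl' with h | h
    · have : 1 ≤ Real.exp (-(s ^ 2 / 2) + s / 2 * stdLevel n p l) :=
        Real.one_le_exp (by nlinarith)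
      have := Real.exp_pos (-(s ^ 2 / 2) + -(s / 2) * stdLevel n p l)
      linarith
    · have : 1 ≤ Real.exp (-(s ^ 2 / 2) + -(s / 2) * stdLevel n p l) :=
        Real.one_le_exp (by nlinarith)
      have := Real.exp_pos (-(s ^ 2 / 2) + s / 2 * stdLevel n p l)
      linarith
  refine (sum_le_sum hpt).trans ?_
  rw [← mul_sum]
  have hsub : ∑ l ∈ (Iic n).filter (fun l => ¬ |stdLevel n p l| ≤ s),
      (binWeight n p l * Real.exp (s / 2 * stdLevel n p l) +
        binWeight n p l * Real.exp (-(s / 2) * stdLevel n p l)) ≤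
      2 * Real.exp (s ^ 2 / 4) := by
    refine (sum_le_sum_of_subset_of_nonneg (filter_subset _ _) fun l _ _ => ?_).trans ?_
    · have := binWeight_nonneg (n := n) hp0 hp1 l
      positivity
    · rw [sum_add_distrib]
      have e : (s / 2) ^ 2 = s ^ 2 / 4 := by ring
      rw [neg_sq, e] at h2
      rw [e] at h1
      linarith
  refine (mul_le_mul_of_nonneg_left hsub (Real.exp_pos _).le).trans_eq ?_
  rw [mul_left_comm, ← Real.exp_add]
  congr 2; ring

theorem sum_binWeight_mul_pow_le (hp0 : 0 ≤ p) (hp1 : p ≤ 1) (hN : 1 ≤ binVar n p) (q : ℕ) :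
    ∑ l ∈ Iic n, binWeight n p l * (1 + |stdLevel n p l|) ^ q ≤ 16 * q.factorial := by
  have hN0 : 0 < binVar n p := by linarith
  have hone : (1 : ℝ) ≤ Real.sqrt (binVar n p) := Real.one_le_sqrt.2 hN
  have h1 := sum_binWeight_mul_exp_stdLevel_le hp0 hp1 hN0 (t := 1) (by simpa using hone)
  have h2 := sum_binWeight_mul_exp_stdLevel_le hp0 hp1 hN0 (t := -1) (by simpa using hone)
  have hpt : ∀ l ∈ Iic n, binWeight n p l * (1 + |stdLevel n p l|) ^ q ≤
      q.factorial * Real.exp 1 * (binWeight n p l * Real.exp (1 * stdLevel n p l) +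
        binWeight n p l * Real.exp (-1 * stdLevel n p l)) := by
    intro l _
    have e1 := Real.pow_div_factorial_le_exp (1 + |stdLevel n p l|) (by positivity) q
    rw [div_le_iff₀ (by positivity), Real.exp_add] at e1
    have e2 : Real.exp |stdLevel n p l| ≤
        Real.exp (1 * stdLevel n p l) + Real.exp (-1 * stdLevel n p l) := by
      have p1 := Real.exp_pos (1 * stdLevel n p l)
      have p2 := Real.exp_pos (-1 * stdLevel n p l)
      rcases abs_cases (stdLevel n p l) with h | h <;> rw [h.1]
      · rw [one_mul] at p1 ⊢; linarith
      · rw [neg_one_mul] at p2 ⊢; linarith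
    have hb := binWeight_nonneg (n := n) hp0 hp1 l
    calc _ ≤ binWeight n p l * (Real.exp 1 * (Real.exp (1 * stdLevel n p l) +
          Real.exp (-1 * stdLevel n p l)) * q.factorial) :=
          mul_le_mul_of_nonneg_left (e1.trans (by gcongr)) hb
      _ = _ := by ring
  refine (sum_le_sum hpt).trans ?_
  rw [← mul_sum, sum_add_distrib]
  norm_num at h1 h2
  have he : Real.exp 1 < 2.7182818286 := Real.exp_one_lt_d9
  have hpos := Real.exp_pos 1
  have hq : (0 : ℝ) < q.factorial := by exact_mod_cast q.factorial_pos
  have h3 : Real.exp 1 * (∑ l ∈ Iic n, binWeight n p l * Real.exp (1 * stdLevel n p l) +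
      ∑ l ∈ Iic n, binWeight n p l * Real.exp (-1 * stdLevel n p l)) ≤ 16 := by
    simp only [one_mul, neg_one_mul]
    nlinarith
  rw [mul_assoc, mul_comm (16 : ℝ)]
  exact mul_le_mul_of_nonneg_left h3 hq.le

/-! ### Errors at a single level -/

theorem cast_eq_add_stdLevel (hN : 0 < binVar n p) (l : ℕ) :
    (l : ℝ) = n * p + stdLevel n p l * Real.sqrt (binVar n p) := by
  rw [stdLevel, div_mul_cancel₀ _ (Real.sqrt_pos.2 hN).ne']; ring

/-- Between levels at distance at most `N / 9` from the mean, a step of the chain loses a fraction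
`O(d / N)` of the norm of a polynomial of degree `d`. -/
theorem step_loss_le (hp0 : 0 < p) (hp1 : p < 1) (hN : 81 ≤ binVar n p) {a m b d : ℕ}
    (hab : a ≤ b) (hbm : b < m) (ha : |stdLevel n p a| ≤ Real.sqrt (binVar n p) / 9)
    (hm : |stdLevel n p m| ≤ Real.sqrt (binVar n p) / 9) :
    d * (n + 1) / (((b : ℝ) + 1) * (n - b)) ≤ 3 / 2 * d / binVar n p := by
  set N := binVar n p with hNdef
  have hN0 : 0 < N := by linarith
  have hs := Real.sqrt_nonneg N
  have hss : Real.sqrt N * Real.sqrt N = N := Real.mul_self_sqrt hN0.le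
  have ea := cast_eq_add_stdLevel hN0 a
  have em := cast_eq_add_stdLevel hN0 m
  rw [← hNdef] at ea em
  have h1 : (a : ℝ) ≤ b := by exact_mod_cast hab
  have h2 : (b : ℝ) + 1 ≤ m := by exact_mod_cast hbm
  have h3 := mul_le_mul_of_nonneg_right (neg_le_of_abs_le ha) hs
  have h4 := mul_le_mul_of_nonneg_right (le_of_abs_le hm) hs
  have hn0 : (0 : ℝ) ≤ n := Nat.cast_nonneg n
  have hNe : N = n * p * (1 - p) := rfl
  have hnp : 0 ≤ n * p := by positivity
  have hnq : 0 ≤ n * (1 - p) := mul_nonneg hn0 (by linarith)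
  have hNp : N ≤ n * p := by rw [hNe]; nlinarith
  have hNq : N ≤ n * (1 - p) := by rw [hNe]; nlinarith
  have hNn : 4 * N ≤ n := by rw [hNe]; nlinarith [sq_nonneg (1 - 2 * p)]
  have hb1 : 8 / 9 * (n * p) ≤ (b : ℝ) + 1 := by nlinarith
  have hb2 : 8 / 9 * (n * (1 - p)) ≤ (n : ℝ) - b := by nlinarith
  have hprod : 64 / 81 * (n * N) ≤ ((b : ℝ) + 1) * (n - b) := by
    refine le_trans (le_of_eq ?_) (mul_le_mul hb1 hb2 (by positivity) (by positivity))
    rw [hNe]; ring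
  have hd : (0 : ℝ) ≤ d := Nat.cast_nonneg d
  have hnpos : (0 : ℝ) < n := by linarith
  rw [div_le_div_iff₀ (lt_of_lt_of_le (by positivity) hprod) hN0]
  have h5 := mul_le_mul_of_nonneg_left hprod (by positivity : (0 : ℝ) ≤ 3 / 2 * d)
  have h6 : (n : ℝ) + 1 ≤ 96 / 81 * n := by linarith
  have h7 := mul_le_mul_of_nonneg_left h6 (by positivity : (0 : ℝ) ≤ d * N)
  nlinarith

section Level

variable {d : ℕ} {η M : ℝ} {k : Fin (d + 1) → ℕ} {c : Finset (Fin n) → ℝ}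

/-- Conditioning happens on the chain at the highest level involved. -/
theorem exists_max_level {r : ℕ} (k : Fin r → ℕ) (l : ℕ) :
    ∃ m, l ≤ m ∧ (∀ i, k i ≤ m) ∧ (m = l ∨ ∃ i, m = k i) := by
  obtain ⟨x, hx, hmax⟩ := exists_max_image (insert l (univ.image k)) id (insert_nonempty _ _)
  refine ⟨x, hmax l (mem_insert_self _ _),
    fun i => hmax _ (mem_insert_of_mem (mem_image_of_mem k (mem_univ i))), ?_⟩
  rcases mem_insert.1 hx with h | h
  · exact Or.inl h
  · obtain ⟨i, _, rfl⟩ := mem_image.1 h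
    exact Or.inr ⟨i, rfl⟩

theorem IsSystem.binVar_ge (hsys : IsSystem n p η M k) (hd : 1 ≤ d)
    (hM : M ≤ Real.sqrt (binVar n p) / (9 * d)) :
    81 ≤ binVar n p ∧ 9 * (d * M) ≤ Real.sqrt (binVar n p) := by
  have hd' : (1 : ℝ) ≤ d := by exact_mod_cast hd
  have h1 := hsys.one_le_M
  rw [le_div_iff₀ (by positivity)] at hM
  have h2 : 9 ≤ Real.sqrt (binVar n p) := by nlinarith
  refine ⟨?_, by linarith⟩
  have := (Real.le_sqrt' (by norm_num)).1 h2
  linarith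

/-- A polynomial bounded on the slices of the system is bounded on every slice in terms of the
weights. Outside the range of the levels the interpolation is exact after conditioning; inside it
the slice is close enough to the top level. -/
theorem IsSystem.expect_sq_le (hp0 : 0 < p) (hp1 : p < 1) (hsys : IsSystem n p η M k)
    (hd : 1 ≤ d) (hM : M ≤ Real.sqrt (binVar n p) / (9 * d)) (hc : ∀ S, d < S.card → c S = 0)
    (hk1 : ∀ i, 𝔼 π : Equiv.Perm (Fin n), ev c (prefixSet π (k i)) ^ 2 ≤ 1) {l : ℕ}
    (hl : l ≤ n) :
    𝔼 π : Equiv.Perm (Fin n), ev c (prefixSet π l) ^ 2 ≤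
      2 * (∑ i, |weight n p k (stdLevel n p l) i|) ^ 2 := by
  obtain ⟨hN81, h9⟩ := hsys.binVar_ge hd hM
  have hN0 : 0 < binVar n p := by linarith
  have hinj := hsys.injective
  have hs := Real.sqrt_pos.2 hN0
  have hd' : (1 : ℝ) ≤ d := by exact_mod_cast hd
  have hM1 := hsys.one_le_M
  have hmono : ∀ a : ℕ, stdLevel n p l ≤ stdLevel n p a → l ≤ a := by
    intro a h
    have := mul_le_mul_of_nonneg_right h hs.le
    have h2 : (l : ℝ) ≤ a := by
      rw [cast_eq_add_stdLevel hN0 l, cast_eq_add_stdLevel hN0 a]; linarith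
    exact_mod_cast h2
  have hmono' : ∀ a : ℕ, stdLevel n p a ≤ stdLevel n p l → a ≤ l := by
    intro a h
    have := mul_le_mul_of_nonneg_right h hs.le
    have h2 : (a : ℝ) ≤ l := by
      rw [cast_eq_add_stdLevel hN0 l, cast_eq_add_stdLevel hN0 a]; linarith
    exact_mod_cast h2
  have hnn := sq_nonneg (∑ i, |weight n p k (stdLevel n p l) i|)
  by_cases hlM : |stdLevel n p l| ≤ M
  · obtain ⟨m, hlm, hkm, hm⟩ := exists_max_level k l
    have hmM : |stdLevel n p m| ≤ M := by
      rcases hm with rfl | ⟨i, rfl⟩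
      exacts [hlM, hsys.bounded i]
    have hmn : m ≤ n := by
      rcases hm with rfl | ⟨i, rfl⟩
      exacts [hl, hsys.le_n i]
    have hM9 : M ≤ Real.sqrt (binVar n p) / 9 := by nlinarith
    refine expect_sq_le_of_near hc (fun s hsd => sum_weight_mul_descFactorial hN0 hinj hsd l)
      hkm hlm hmn hk1 (θ := 3 / 2 * d / binVar n p)
      (fun b hb hbm => step_loss_le hp0 hp1 hN81 hb hbm (hlM.trans hM9) (hmM.trans hM9)) ?_
    have h1 : (m : ℝ) - l ≤ 2 * M * Real.sqrt (binVar n p) := by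
      rw [cast_eq_add_stdLevel hN0 m, cast_eq_add_stdLevel hN0 l]
      have := mul_le_mul_of_nonneg_right
        (by linarith [le_of_abs_le hmM, neg_le_of_abs_le hlM] :
          stdLevel n p m - stdLevel n p l ≤ 2 * M) hs.le
      linarith
    refine (mul_le_mul_of_nonneg_right h1 (by positivity)).trans ?_
    rw [mul_div_assoc', div_le_iff₀ hN0]
    have := mul_le_mul_of_nonneg_right h9 hs.le
    rw [Real.mul_self_sqrt hN0.le] at this
    nlinarith
  · rcases lt_abs.1 (not_le.1 hlM) with h | h
    · have := expect_sq_le_of_ge hc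
        (fun s hsd => sum_weight_mul_descFactorial hN0 hinj hsd l)
        (fun i => hmono' _ (by linarith [le_of_abs_le (hsys.bounded i)])) hl hk1
      linarith
    · have := expect_sq_le_of_le hc
        (fun s hsd => sum_weight_mul_descFactorial_sub hN0 hinj hsys.le_n hsd hl)
        (fun i => hmono _ (by linarith [neg_le_of_abs_le (hsys.bounded i)])) hsys.le_n hl hk1
      linarith

/-- At a level within `N / 9` of the mean, interpolation along the chain is accurate up to an `L₁`
error of order `N ^ (-1 / 4)`; here `r` stands for `N ^ (1 / 4)`. -/
theorem IsSystem.expect_abs_sub_le (hp0 : 0 < p) (hp1 : p < 1) (hsys : IsSystem n p η M k)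
    (hd : 1 ≤ d) (hM : M ≤ Real.sqrt (binVar n p) / (9 * d)) (hc : ∀ S, d < S.card → c S = 0)
    (hk1 : ∀ i, 𝔼 π : Equiv.Perm (Fin n), ev c (prefixSet π (k i)) ^ 2 ≤ 1) {l : ℕ}
    (hl : l ≤ n) (hlσ : |stdLevel n p l| ≤ Real.sqrt (binVar n p) / 9) {r : ℝ} (hr : 0 < r)
    (hr4 : r ^ 2 = Real.sqrt (binVar n p)) :
    𝔼 π : Equiv.Perm (Fin n), |ev c (prefixSet π l) -
        ∑ i, weight n p k (stdLevel n p l) i * ev c (prefixSet π (k i))| ≤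
      6 * (d * M) * (1 + |stdLevel n p l|) *
        (∑ i, |weight n p k (stdLevel n p l) i|) / r := by
  obtain ⟨hN81, h9⟩ := hsys.binVar_ge hd hM
  have hN0 : 0 < binVar n p := by linarith
  have hinj := hsys.injective
  have hs := Real.sqrt_pos.2 hN0
  have hd' : (1 : ℝ) ≤ d := by exact_mod_cast hd
  have hM1 := hsys.one_le_M
  have hM9 : M ≤ Real.sqrt (binVar n p) / 9 := by nlinarith
  set Γ := ∑ i, |weight n p k (stdLevel n p l) i| with hΓ
  have hΓ0 : 0 ≤ Γ := sum_nonneg fun _ _ => abs_nonneg _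
  obtain ⟨m, hlm, hkm, hm⟩ := exists_max_level k l
  set u := 1 + |stdLevel n p l| with hu
  have hu1 : 1 ≤ u := by rw [hu]; linarith [abs_nonneg (stdLevel n p l)]
  have hmM : |stdLevel n p m| ≤ M * u := by
    rcases hm with rfl | ⟨i, rfl⟩
    · nlinarith [abs_nonneg (stdLevel n p m)]
    · nlinarith [hsys.bounded i]
  have hm9 : |stdLevel n p m| ≤ Real.sqrt (binVar n p) / 9 := by
    rcases hm with rfl | ⟨i, rfl⟩
    exacts [hlσ, (hsys.bounded i).trans hM9]
  have hmn : m ≤ n := by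
    rcases hm with rfl | ⟨i, rfl⟩
    exacts [hl, hsys.le_n i]
  have hdM1 : 1 ≤ d * M := by nlinarith
  have hdist : ∀ a : ℕ, |stdLevel n p a| ≤ M * u →
      ((m : ℝ) - a) * (3 / 2 * d / binVar n p) ≤ (2 * (d * M) * u / r) ^ 2 := by
    intro a ha
    have h1 : (m : ℝ) - a ≤ 2 * (M * u) * Real.sqrt (binVar n p) := by
      rw [cast_eq_add_stdLevel hN0 m, cast_eq_add_stdLevel hN0 a]
      have := mul_le_mul_of_nonneg_right
        (by linarith [le_of_abs_le hmM, neg_le_of_abs_le ha] :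
          stdLevel n p m - stdLevel n p a ≤ 2 * (M * u)) hs.le
      linarith
    refine (mul_le_mul_of_nonneg_right h1 (by positivity)).trans ?_
    rw [div_pow, hr4, mul_div_assoc', div_le_div_iff₀ hN0 hs]
    have e : 2 * (M * u) * Real.sqrt (binVar n p) * (3 / 2 * d) * Real.sqrt (binVar n p) =
        3 * (d * M * u) * binVar n p := by
      rw [← Real.mul_self_sqrt hN0.le, Real.sqrt_mul_self hs.le]; ring
    rw [e]
    refine mul_le_mul_of_nonneg_right ?_ hN0.le
    have : 1 ≤ d * M * u := by nlinarith
    nlinarith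
  have h := expect_abs_sub_interpolation_le hc
    (fun s hsd => sum_weight_mul_descFactorial hN0 hinj hsd l) hkm hlm hmn hk1
    (θ := 3 / 2 * d / binVar n p) (δ := 2 * (d * M) * u / r) (Λ := 2 * Γ) ?_ (by positivity)
    (hdist l (by nlinarith [abs_nonneg (stdLevel n p l)]))
    (fun i => hdist (k i) (by nlinarith [hsys.bounded i])) (by positivity) ?_
  · refine h.trans_eq ?_
    rw [← hΓ]; ring
  · rintro b (hb | ⟨i, hb⟩) hbm
    · exact step_loss_le hp0 hp1 hN81 hb hbm hlσ hm9
    · exact step_loss_le hp0 hp1 hN81 hb hbm ((hsys.bounded i).trans hM9) hm9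
  · refine (hsys.expect_sq_le hp0 hp1 hd hM hc hk1 hl).trans ?_
    rw [← hΓ]; nlinarith [sq_nonneg Γ]

end Level

end Levels

section Measures

variable {n : ℕ}

/-! ### The measures of the statement as finite averages -/

/-- The point of `{0,1}^n` with support `x`. -/
def indicatorPoint (x : Finset (Fin n)) : Fin n → ℝ := fun i => if i ∈ x then 1 else 0

theorem chain_eq_indicatorPoint (π : Equiv.Perm (Fin n)) (s : ℕ) :
    chain π s = indicatorPoint (prefixSet π s) := by
  ext i; simp [chain, indicatorPoint, mem_prefixSet]

/-- On the cube, a polynomial is the multilinear one obtained by reducing all its exponents. -/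
theorem exists_eval_eq_ev (f : MvPolynomial (Fin n) ℝ) {d : ℕ} (hf : f.totalDegree ≤ d) :
    ∃ c : Finset (Fin n) → ℝ, (∀ S, d < S.card → c S = 0) ∧
      ∀ x, MvPolynomial.eval (indicatorPoint x) f = ev c x := by
  refine ⟨fun S => ∑ m ∈ f.support.filter (fun m => m.support = S), f.coeff m, ?_, ?_⟩
  · intro S hS
    refine sum_eq_zero fun m hm => absurd hS ?_
    obtain ⟨hm', rfl⟩ := mem_filter.1 hm
    have h1 := MvPolynomial.le_totalDegree hm'
    have h2 : m.support.card ≤ m.sum fun _ e => e := by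
      rw [Finsupp.sum, card_eq_sum_ones]
      exact sum_le_sum fun i hi => Nat.one_le_iff_ne_zero.2 (Finsupp.mem_support_iff.1 hi)
    omega
  · intro x
    rw [MvPolynomial.eval_eq, ev_eq]
    simp_rw [← sum_filter]
    have h1 : ∀ m : Fin n →₀ ℕ, ∏ i ∈ m.support, indicatorPoint x i ^ m i =
        if m.support ⊆ x then 1 else 0 := by
      intro m
      split_ifs with h
      · exact prod_eq_one fun i hi => by simp [indicatorPoint, h hi]
      · obtain ⟨i, hi, hix⟩ := not_subset.1 h
        refine prod_eq_zero hi ?_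
        simp [indicatorPoint, hix, Finsupp.mem_support_iff.1 hi]
    simp_rw [h1, mul_ite, mul_one, mul_zero]
    rw [← sum_filter, ← sum_fiberwise_of_maps_to (t := univ.filter fun S => S ⊆ x)
      (g := fun m : Fin n →₀ ℕ => m.support) (fun m hm => by simpa using (mem_filter.1 hm).2)]
    refine sum_congr rfl fun S hS => ?_
    rw [filter_filter]
    refine sum_congr (filter_congr fun m _ => ?_) fun _ _ => rfl
    have hS' : S ⊆ x := by simpa using hS
    exact ⟨fun h => h.2, fun h => ⟨h ▸ hS', h⟩⟩

theorem indicatorPoint_injective : Function.Injective (indicatorPoint (n := n)) := by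
  intro x y h
  ext i
  have := congrFun h i
  by_cases h1 : i ∈ x <;> by_cases h2 : i ∈ y <;> simp_all [indicatorPoint]

theorem sum_indicatorPoint (x : Finset (Fin n)) : ∑ i, indicatorPoint x i = x.card := by
  simp [indicatorPoint]

theorem slice_eq_coe_image (n k : ℕ) :
    slice n k = ((powersetCard k univ).image (indicatorPoint (n := n)) : Set (Fin n → ℝ)) := by
  ext y
  simp only [slice, Set.mem_ofPred_eq, mem_image, mem_coe, mem_powersetCard_univ]
  constructor
  · rintro ⟨h01, hsum⟩
    have hy : indicatorPoint (univ.filter fun i => y i = 1) = y := by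
      ext i
      rcases h01 i with h | h <;> simp [indicatorPoint, h]
    refine ⟨_, ?_, hy⟩
    rw [← hy, sum_indicatorPoint] at hsum
    exact_mod_cast hsum
  · rintro ⟨x, rfl, rfl⟩
    refine ⟨fun i => ?_, sum_indicatorPoint x⟩
    by_cases h : i ∈ x <;> simp [indicatorPoint, h]

theorem integral_uniformOn_finset {Ω : Type*} [MeasurableSpace Ω] [MeasurableSingletonClass Ω]
    (s : Finset Ω) (g : Ω → ℝ) :
    ∫ x, g x ∂(uniformOn (s : Set Ω)) = (∑ x ∈ s, g x) / s.card := by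
  classical
  have h1 : (uniformOn (s : Set Ω)).restrict s = uniformOn (s : Set Ω) :=
    Measure.restrict_eq_self_of_ae_mem (ae_cond_mem s.measurableSet)
  rw [← h1, setIntegral_finset s IntegrableOn.finset, sum_div]
  refine sum_congr rfl fun x hx => ?_
  rw [measureReal_def, ← coe_singleton, uniformOn_apply_finset]
  simp [hx, div_eq_inv_mul]

theorem integral_sliceMeasure {k : ℕ} (hk : k ≤ n) (g : (Fin n → ℝ) → ℝ) :
    ∫ x, g x ∂(sliceMeasure n k) =
      𝔼 π : Equiv.Perm (Fin n), g (indicatorPoint (prefixSet π k)) := by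
  classical
  rw [sliceMeasure, slice_eq_coe_image, integral_uniformOn_finset,
    sum_image indicatorPoint_injective.injOn, card_image_of_injective _ indicatorPoint_injective,
    card_powersetCard, card_univ, Fintype.card_fin,
    expect_prefixSet (fun x => g (indicatorPoint x)) hk]

theorem integral_cubeMeasure_eq_sum (p : unitInterval) (g : (Fin n → ℝ) → ℝ)
    (hg : Measurable g) :
    ∫ x, g x ∂(cubeMeasure n p) =
      ∑ x : Finset (Fin n), (p : ℝ) ^ x.card * (1 - p) ^ (n - x.card) * g (indicatorPoint x) := by
  let h : Bool → ℝ := fun b => if b then 1 else 0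
  have hh : Measurable h := measurable_of_finite h
  have hmap : Measure.map h (bernoulliMeasure true false p) = bernoulliMeasure (1 : ℝ) 0 p := by
    rw [bernoulliMeasure_def, bernoulliMeasure_def, Measure.map_add _ _ hh, Measure.map_smul,
      Measure.map_smul, Measure.map_dirac, Measure.map_dirac]
    simp [h]
  have hpi : cubeMeasure n p = Measure.map (fun (b : Fin n → Bool) i => h (b i))
      (Measure.pi fun _ : Fin n => bernoulliMeasure true false p) := by
    rw [Measure.pi_map_pi fun _ => hh.aemeasurable, hmap, cubeMeasure]
  rw [hpi, integral_map (measurable_of_finite _).aemeasurable hg.aestronglyMeasurable,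
    integral_fintype Integrable.of_finite]
  let e : (Fin n → Bool) ≃ Finset (Fin n) :=
    { toFun := fun b => univ.filter fun i => b i = true
      invFun := fun x i => decide (i ∈ x)
      left_inv := fun b => by ext i; simp
      right_inv := fun x => by ext i; simp }
  refine Fintype.sum_equiv e _ _ fun b => ?_
  have e1 : (fun i => h (b i)) = indicatorPoint (e b) := by
    ext i; simp [h, indicatorPoint, e]
  have e2 : (Measure.pi fun _ : Fin n => bernoulliMeasure true false p).real {b} =
      (p : ℝ) ^ (e b).card * (1 - p) ^ (n - (e b).card) := by
    rw [measureReal_def, Measure.pi_singleton, ENNReal.toReal_prod]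
    have : ∀ i, ((bernoulliMeasure true false p) {b i}).toReal =
        if b i = true then (p : ℝ) else 1 - p := by
      intro i
      rw [← measureReal_def, bernoulliMeasure_real_apply _ (measurableSet_singleton _)]
      cases b i <;> simp
    simp_rw [this]
    rw [prod_ite, prod_const, prod_const]
    congr 2
    rw [filter_not, card_sdiff_of_subset (filter_subset _ _), card_univ, Fintype.card_fin]
    rfl
  rw [e1, e2, smul_eq_mul]

theorem integral_cubeMeasure (p : unitInterval) (g : (Fin n → ℝ) → ℝ) (hg : Measurable g) :
    ∫ x, g x ∂(cubeMeasure n p) = ∑ l ∈ Iic n, binWeight n p l *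
      𝔼 π : Equiv.Perm (Fin n), g (indicatorPoint (prefixSet π l)) := by
  rw [integral_cubeMeasure_eq_sum p g hg,
    ← sum_fiberwise_of_maps_to (t := Iic n) (g := fun x : Finset (Fin n) => x.card)
      (fun x _ => mem_Iic.2 (card_finset_fin_le x))]
  refine sum_congr rfl fun l hl => ?_
  have hl' : l ≤ n := mem_Iic.1 hl
  have hc : (n.choose l : ℝ) ≠ 0 := by exact_mod_cast (Nat.choose_pos hl').ne'
  rw [expect_prefixSet (fun x => g (indicatorPoint x)) hl', binWeight]
  have hset : (univ.filter fun x : Finset (Fin n) => x.card = l) = powersetCard l univ := by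
    ext; simp
  rw [hset, sum_congr rfl fun x hx => by rw [(mem_powersetCard.1 hx).2], ← mul_sum]
  field_simp

theorem integral_binomial_restrict (p : unitInterval) (A : Set ℕ) [DecidablePred (· ∈ A)]
    (G : ℕ → ℝ) :
    ∫ l in A, G l ∂(binomial n p) = ∑ l ∈ (Iic n).filter (· ∈ A), binWeight n p l * G l := by
  rw [← integral_indicator MeasurableSet.of_discrete, integral_binomial, sum_filter]
  refine sum_congr rfl fun l _ => ?_
  rw [Set.indicator_apply, smul_eq_mul]
  split_ifs <;> simp [binWeight]

theorem integral_condBinomial (p : unitInterval) (s : ℝ) (G : ℕ → ℝ) :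
    ∫ l, G l ∂(condBinomial n p s) =
      (∑ l ∈ (Iic n).filter (fun l => |stdLevel n p l| ≤ s), binWeight n p l * G l) /
        ∑ l ∈ (Iic n).filter (fun l => |stdLevel n p l| ≤ s), binWeight n p l := by
  classical
  have h1 := integral_binomial_restrict (n := n) p {l | |stdLevel n p l| ≤ s} G
  have h2 := integral_binomial_restrict (n := n) p {l | |stdLevel n p l| ≤ s} fun _ => 1
  simp only [Set.mem_ofPred_eq, mul_one, setIntegral_const, smul_eq_mul] at h1 h2
  rw [condBinomial, ProbabilityTheory.cond, integral_smul_measure, h1, smul_eq_mul,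
    ENNReal.toReal_inv, ← measureReal_def, h2, div_eq_inv_mul]

theorem integral_interpolated {r : ℕ} (p : unitInterval) (f : MvPolynomial (Fin n) ℝ)
    (k : Fin r → ℕ) (s : ℝ) (φ : ℝ → ℝ) (hφ : Measurable φ) :
    ∫ y, φ y ∂(interpolated p f k s) = ∫ l, 𝔼 π : Equiv.Perm (Fin n),
      φ (∑ i, weight n p k (stdLevel n p l) i * MvPolynomial.eval (chain π (k i)) f)
        ∂(condBinomial n p s) := by
  let _ : MeasurableSpace (Equiv.Perm (Fin n)) := ⊤
  have : DiscreteMeasurableSpace (Equiv.Perm (Fin n)) := ⟨fun _ => trivial⟩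
  set P : Measure (Equiv.Perm (Fin n)) := (PMF.uniformOfFintype (Equiv.Perm (Fin n))).toMeasure
  let F : Equiv.Perm (Fin n) → Fin r → ℝ := fun π i => MvPolynomial.eval (chain π (k i)) f
  have hF : Measurable F := measurable_of_finite F
  have hprof : profile f k = P.map F := (PMF.toMeasure_map F _ hF).symm
  let H : ℕ × (Fin r → ℝ) → ℝ := fun z => ∑ i, weight n p k (stdLevel n p z.1) i * z.2 i
  have hH : Measurable H := by
    refine measurable_from_prod_countable_right fun l => ?_
    simp only [H]
    fun_prop
  have : SFinite (condBinomial n p s) := by unfold condBinomial; infer_instance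
  have : IsFiniteMeasure (condBinomial n p s) := by unfold condBinomial; infer_instance
  have hprod : (condBinomial n p s).prod (profile f k) =
      ((condBinomial n p s).prod P).map (Prod.map id F) := by
    rw [hprof, ← Measure.map_prod_map _ _ measurable_id hF, Measure.map_id]
  have hint : interpolated p f k s = ((condBinomial n p s).prod P).map (H ∘ Prod.map id F) := by
    rw [interpolated, hprod, Measure.map_map hH (measurable_id.prodMap hF)]
  have hae : ∀ᵐ l ∂(condBinomial n p s), l ≤ n := by
    refine cond_absolutelyContinuous.ae_le ?_
    exact ae_le_of_hasLaw_binomial HasLaw.id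
  let Φ : ℕ × Equiv.Perm (Fin n) → ℝ := fun z => φ (H (z.1, F z.2))
  have hΦ : Integrable Φ ((condBinomial n p s).prod P) := by
    refine Integrable.of_bound (Measurable.of_discrete).aestronglyMeasurable
      (∑ l ∈ Iic n, ∑ π, |Φ (l, π)|) ?_
    have := Measure.quasiMeasurePreserving_fst (μ := condBinomial n p s) (ν := P) |>.ae hae
    filter_upwards [this] with z hz
    rw [Real.norm_eq_abs]
    refine le_trans ?_ (single_le_sum (f := fun l => ∑ π, |Φ (l, π)|)
      (fun _ _ => sum_nonneg fun _ _ => abs_nonneg _) (mem_Iic.2 hz))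
    exact single_le_sum (f := fun π => |Φ (z.1, π)|) (fun _ _ => abs_nonneg _) (mem_univ z.2)
  rw [hint, integral_map (Measurable.of_discrete).aemeasurable hφ.aestronglyMeasurable]
  change ∫ z, Φ z ∂((condBinomial n p s).prod P) = _
  rw [integral_prod _ hΦ]
  refine integral_congr_ae (Filter.Eventually.of_forall fun l => ?_)
  simp only [P]
  rw [PMF.integral_eq_sum, Fintype.expect_eq_sum_div_card, sum_div]
  refine sum_congr rfl fun π _ => ?_
  rw [PMF.uniformOfFintype_apply, ENNReal.toReal_inv, ENNReal.toReal_natCast, smul_eq_mul,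
    div_eq_inv_mul]

end Measures

section Assembly

/-! ### Assembling the levels -/

/-- Comparing an average with an average conditioned on a likely event: the two quantities agree up
to `1 / r` on the event, whose complement has probability `O(1 / r²)`. -/
theorem abs_sum_sub_conditioned_le {ι : Type*} (I : Finset ι) (b : ι → ℝ) (good : ι → Prop)
    [DecidablePred good] (hb : ∀ l ∈ I, 0 ≤ b l) (hb1 : ∑ l ∈ I, b l = 1) (u v Y : ι → ℝ)
    {r Q : ℝ} (hr : 0 < r) (hQ : 0 ≤ Q) (hY : ∀ l ∈ I, 0 ≤ Y l)
    (hu : ∀ l ∈ I, |u l| ≤ Y l) (hv : ∀ l ∈ I, |v l| ≤ Y l)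
    (huv : ∀ l ∈ I, good l → |u l - v l| ≤ Y l / r)
    (hYQ : ∑ l ∈ I, b l * Y l ^ 2 ≤ Q ^ 2)
    (hbad : ∑ l ∈ I.filter (fun l => ¬ good l), b l ≤ (2 / r) ^ 2)
    (hbad' : ∑ l ∈ I.filter (fun l => ¬ good l), b l ≤ 1 / 2) :
    |(∑ l ∈ I, b l * u l) - (∑ l ∈ I.filter good, b l * v l) / ∑ l ∈ I.filter good, b l| ≤
      7 * Q / r := by
  set P := ∑ l ∈ I.filter (fun l => ¬ good l), b l with hP
  set Z := ∑ l ∈ I.filter good, b l with hZ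
  have hP0 : 0 ≤ P := sum_nonneg fun l hl => hb l (mem_filter.1 hl).1
  have hZP : Z + P = 1 := by rw [hZ, hP, sum_filter_add_sum_filter_not, hb1]
  have hZ2 : 1 / 2 ≤ Z := by linarith
  have hYall : ∑ l ∈ I, b l * Y l ≤ Q := by
    refine abs_le_of_sq_le_sq' ?_ hQ |>.2
    refine (sum_sq_le_sum_mul_sum_of_sq_le_mul I (f := b) (g := fun l => b l * Y l ^ 2) hb
      (fun l hl => mul_nonneg (hb l hl) (sq_nonneg _)) fun l _ => le_of_eq (by ring)).trans ?_
    rwa [hb1, one_mul]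
  -- Cauchy–Schwarz turns the bound `O(1 / r²)` for the complement into `O(1 / r)`.
  have hYbad : ∑ l ∈ I.filter (fun l => ¬ good l), b l * Y l ≤ 2 / r * Q := by
    refine abs_le_of_sq_le_sq' ?_ (by positivity) |>.2
    refine (sum_sq_le_sum_mul_sum_of_sq_le_mul _ (f := b) (g := fun l => b l * Y l ^ 2)
      (fun l hl => hb l (mem_filter.1 hl).1)
      (fun l hl => mul_nonneg (hb l (mem_filter.1 hl).1) (sq_nonneg _))
      fun l _ => le_of_eq (by ring)).trans ?_
    rw [mul_pow]
    refine mul_le_mul hbad (le_trans ?_ hYQ)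
      (sum_nonneg fun l hl => mul_nonneg (hb l (mem_filter.1 hl).1) (sq_nonneg _)) (by positivity)
    exact sum_le_sum_of_subset_of_nonneg (filter_subset _ _)
      fun l hl _ => mul_nonneg (hb l hl) (sq_nonneg _)
  have habs : ∀ (J : Finset ι) (w X : ι → ℝ), J ⊆ I → (∀ l ∈ J, |w l| ≤ X l) →
      |∑ l ∈ J, b l * w l| ≤ ∑ l ∈ J, b l * X l := by
    intro J w X hJ hw
    refine (abs_sum_le_sum_abs _ _).trans (sum_le_sum fun l hl => ?_)
    rw [abs_mul, abs_of_nonneg (hb l (hJ hl))]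
    exact mul_le_mul_of_nonneg_left (hw l hl) (hb l (hJ hl))
  have hYgood : ∑ l ∈ I.filter good, b l * Y l ≤ Q :=
    (sum_le_sum_of_subset_of_nonneg (filter_subset _ _)
      fun l hl _ => mul_nonneg (hb l hl) (hY l hl)).trans hYall
  set Vg := ∑ l ∈ I.filter good, b l * v l with hVg
  have hVgQ : |Vg| ≤ Q := (habs _ v Y (filter_subset _ _)
    fun l hl => hv l (mem_filter.1 hl).1).trans hYgood
  have h1 : |∑ l ∈ I.filter good, b l * (u l - v l)| ≤ Q / r := by
    refine (habs _ (fun l => u l - v l) (fun l => Y l / r) (filter_subset _ _)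
      fun l hl => huv l (mem_filter.1 hl).1 (mem_filter.1 hl).2).trans ?_
    simp_rw [← mul_div_assoc]
    rw [← sum_div]
    gcongr
  have h2 : |∑ l ∈ I.filter (fun l => ¬ good l), b l * u l| ≤ 2 / r * Q :=
    (habs _ u Y (filter_subset _ _) fun l hl => hu l (mem_filter.1 hl).1).trans hYbad
  have hPr : P ≤ 2 / r := by
    have h2r : 0 ≤ 2 / r := by positivity
    by_contra hcon
    nlinarith
  have h3 : |P / Z * Vg| ≤ 2 * (2 / r) * Q := by
    rw [abs_mul, abs_of_nonneg (by positivity)]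
    refine mul_le_mul ?_ hVgQ (abs_nonneg _) (by positivity)
    rw [div_le_iff₀ (by linarith)]
    have : 0 ≤ 2 / r := by positivity
    nlinarith
  have hZ0 : Z ≠ 0 := by linarith
  have hsplit : (∑ l ∈ I, b l * u l) - Vg / Z =
      ∑ l ∈ I.filter good, b l * (u l - v l) +
        ∑ l ∈ I.filter (fun l => ¬ good l), b l * u l - P / Z * Vg := by
    simp_rw [mul_sub]
    rw [sum_sub_distrib, ← sum_filter_add_sum_filter_not I good (fun l => b l * u l), ← hVg]
    have : P = 1 - Z := by linarith
    rw [this]; field_simp; ring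
  rw [hsplit]
  refine (abs_sub _ _).trans ((add_le_add (abs_add_le _ _) le_rfl).trans ?_)
  have : Q / r + 2 / r * Q + 2 * (2 / r) * Q = 7 * Q / r := by ring
  linarith

/-- All the factors depending on `d`, `M` and `η` are absorbed into one power. -/
theorem factorial_mul_bound_le {d : ℕ} (hd : 1 ≤ d) {M ρ D : ℝ} (hM : 1 ≤ M) (hMρ : M ≤ ρ)
    (hD : d * ρ ≤ D) :
    7 * (6 * (d * M) * ((d + 1) * ρ ^ d) * (16 * (2 * d + 2).factorial)) ≤
      (5376 * D) ^ (7 * d) := by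
  have hd' : (1 : ℝ) ≤ d := by exact_mod_cast hd
  have hρ : 1 ≤ ρ := hM.trans hMρ
  have hdD : (d : ℝ) ≤ D := by nlinarith
  have hρD : ρ ≤ D := by nlinarith
  have hD1 : 1 ≤ D := hd'.trans hdD
  have e1 : d * M ≤ D := by nlinarith
  have e2 : (d : ℝ) + 1 ≤ 2 * D := by linarith
  have e3 : ρ ^ d ≤ (5376 * D) ^ d := pow_le_pow_left₀ (by linarith) (by linarith) d
  have e4 : ((2 * d + 2).factorial : ℝ) ≤ (5376 * D) ^ (4 * d) := by
    have h1 : ((2 * d + 2).factorial : ℝ) ≤ ((2 * d + 2 : ℕ) : ℝ) ^ (2 * d + 2) := by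
      exact_mod_cast Nat.factorial_le_pow _
    refine h1.trans ?_
    have h2 : ((2 * d + 2 : ℕ) : ℝ) ≤ 5376 * D := by push_cast; linarith
    refine (pow_le_pow_left₀ (by positivity) h2 _).trans ?_
    exact pow_le_pow_right₀ (by linarith) (by omega)
  have e5 : 1344 * D * D ≤ (5376 * D) ^ (2 * d) := by
    refine le_trans ?_ (pow_le_pow_right₀ (by linarith : (1 : ℝ) ≤ 5376 * D)
      (by omega : 2 ≤ 2 * d))
    nlinarith
  calc 7 * (6 * (d * M) * ((d + 1) * ρ ^ d) * (16 * (2 * d + 2).factorial))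
      ≤ 7 * (6 * D * ((2 * D) * (5376 * D) ^ d) * (16 * (5376 * D) ^ (4 * d))) := by gcongr
    _ = (1344 * D * D) * ((5376 * D) ^ d * (5376 * D) ^ (4 * d)) := by ring
    _ ≤ (5376 * D) ^ (2 * d) * ((5376 * D) ^ d * (5376 * D) ^ (4 * d)) := by gcongr
    _ = (5376 * D) ^ (7 * d) := by rw [← pow_add, ← pow_add]; congr 1; ring

/-- The truncation at `√(3 log N)` is far inside the range `√N / 9`. -/
theorem sqrt_log_le {N : ℝ} (hN : 1 ≤ N) (hlog : 256 * Real.log N ≤ N) :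
    Real.sqrt (3 * Real.log N) ≤ Real.sqrt N / 9 := by
  have hlog0 : 0 ≤ Real.log N := Real.log_nonneg hN
  refine abs_le_of_sq_le_sq' ?_ (by positivity) |>.2
  rw [Real.sq_sqrt (by positivity), div_pow, Real.sq_sqrt (by linarith)]
  linarith

/-- The tail beyond `√(3 log N)` has probability `O(N ^ (-3 / 4))`; the bound `O(N ^ (-1 / 2))` is
what Cauchy–Schwarz needs to produce an error `O(N ^ (-1 / 4))`. -/
theorem sum_binWeight_log_tail_le {n : ℕ} {p : ℝ} (hp0 : 0 ≤ p) (hp1 : p ≤ 1)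
    (hN : 1 ≤ binVar n p) (hlog : 256 * Real.log (binVar n p) ≤ binVar n p) :
    ∑ l ∈ (Iic n).filter (fun l => ¬ |stdLevel n p l| ≤ Real.sqrt (3 * Real.log (binVar n p))),
      binWeight n p l ≤ 2 / Real.sqrt (binVar n p) := by
  have hN0 : 0 < binVar n p := by linarith
  have hlog0 : 0 ≤ Real.log (binVar n p) := Real.log_nonneg hN
  have hs := sqrt_log_le hN hlog
  refine (sum_binWeight_tail_le hp0 hp1 hN0 (Real.sqrt_nonneg _)
    (by linarith [Real.sqrt_nonneg (binVar n p)])).trans ?_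
  have h1 : Real.exp (Real.log (binVar n p) / 2) = Real.sqrt (binVar n p) := by
    rw [Real.sqrt_eq_rpow, Real.rpow_def_of_pos hN0]; congr 1; ring
  rw [Real.sq_sqrt (by positivity), ← h1, div_eq_mul_inv 2 (Real.exp _), ← Real.exp_neg]
  exact mul_le_mul_of_nonneg_left (Real.exp_le_exp.2 (by linarith)) (by norm_num)

variable {n d : ℕ} {η M : ℝ} {k : Fin (d + 1) → ℕ}

/-- The quantitative comparison, for a function `ev c` of degree at most `d` on the cube. -/
theorem IsSystem.abs_sum_sub_interpolated_le {p : ℝ} {c : Finset (Fin n) → ℝ}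
    (hp0 : 0 < p) (hp1 : p < 1) (hsys : IsSystem n p η M k)
    (hd : 1 ≤ d) (hM : M ≤ Real.sqrt (binVar n p) / (9 * d)) (hc : ∀ S, d < S.card → c S = 0)
    (hk1 : ∀ i, 𝔼 π : Equiv.Perm (Fin n), ev c (prefixSet π (k i)) ^ 2 ≤ 1)
    (hlog : 256 * Real.log (binVar n p) ≤ binVar n p) {φ : ℝ → ℝ} (hφ : LipschitzWith 1 φ)
    (hφ0 : φ 0 = 0) {s : ℝ} (hs : s = Real.sqrt (3 * Real.log (binVar n p))) :
    |(∑ l ∈ Iic n, binWeight n p l * 𝔼 π : Equiv.Perm (Fin n), φ (ev c (prefixSet π l))) -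
      (∑ l ∈ (Iic n).filter (fun l => |stdLevel n p l| ≤ s), binWeight n p l *
        𝔼 π : Equiv.Perm (Fin n),
          φ (∑ i, weight n p k (stdLevel n p l) i * ev c (prefixSet π (k i)))) /
        ∑ l ∈ (Iic n).filter (fun l => |stdLevel n p l| ≤ s), binWeight n p l| ≤
      7 * (6 * (d * M) * ((d + 1) * (M / η) ^ d) * (16 * (2 * d + 2).factorial)) /
        binVar n p ^ (1 / 4 : ℝ) := by
  obtain ⟨hN81, h9⟩ := hsys.binVar_ge hd hM
  have hM1 := hsys.one_le_M
  have hη := hsys.eta_pos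
  have hd' : (1 : ℝ) ≤ d := by exact_mod_cast hd
  set N := binVar n p with hN
  have hN0 : 0 < N := by linarith
  have hsN := Real.sqrt_pos.2 hN0
  set r := N ^ (1 / 4 : ℝ) with hr
  have hr0 : 0 < r := Real.rpow_pos_of_pos hN0 _
  have hr2 : r ^ 2 = Real.sqrt N := by
    rw [hr, ← Real.rpow_natCast, ← Real.rpow_mul hN0.le, Real.sqrt_eq_rpow]; norm_num
  have hs9 : s ≤ Real.sqrt N / 9 := hs ▸ sqrt_log_le (by linarith) hlog
  have hφabs : ∀ x, |φ x| ≤ |x| := by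
    intro x
    have := hφ.dist_le_mul x 0
    simpa [Real.dist_eq, hφ0] using this
  have hφsub : ∀ x y, |φ x - φ y| ≤ |x - y| := by
    intro x y
    have := hφ.dist_le_mul x y
    simpa [Real.dist_eq] using this
  -- `B (1 + |σ|) ^ (d + 1)` dominates all the quantities attached to a level `σ`.
  set B := 6 * (d * M) * ((d + 1) * (M / η) ^ d) with hB
  have hMη : 0 < M / η := by positivity
  have hB0 : 0 ≤ B := by positivity
  set Γ : ℕ → ℝ := fun l => ∑ i, |weight n p k (stdLevel n p l) i| with hΓ
  have hΓ0 : ∀ l, 0 ≤ Γ l := fun l => sum_nonneg fun _ _ => abs_nonneg _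
  have hΓle : ∀ l, 6 * (d * M) * (1 + |stdLevel n p l|) * Γ l ≤
      B * (1 + |stdLevel n p l|) ^ (d + 1) := by
    intro l
    have h1 : Γ l ≤ (d + 1) * ((1 + |stdLevel n p l|) * (M / η)) ^ d := by
      refine (sum_le_card_nsmul _ _ _ fun i _ => hsys.abs_weight_le _ i).trans_eq ?_
      simp
    calc _ ≤ 6 * (d * M) * (1 + |stdLevel n p l|) *
          ((d + 1) * ((1 + |stdLevel n p l|) * (M / η)) ^ d) := by gcongr
      _ = _ := by rw [hB, mul_pow]; ring
  have hdM : 1 ≤ d * M := by nlinarith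
  have hΓ2 : ∀ l, 2 * Γ l ≤ B * (1 + |stdLevel n p l|) ^ (d + 1) := by
    intro l
    refine le_trans (mul_le_mul_of_nonneg_right ?_ (hΓ0 l)) (hΓle l)
    nlinarith [abs_nonneg (stdLevel n p l)]
  have hFl : ∀ l ∈ Iic n, 𝔼 π : Equiv.Perm (Fin n), |ev c (prefixSet π l)| ≤ 2 * Γ l := by
    intro l hl
    refine expect_abs_le_of_sq_le _ (by linarith [hΓ0 l]) ?_
    refine (hsys.expect_sq_le hp0 hp1 hd hM hc hk1 (mem_Iic.1 hl)).trans ?_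
    rw [mul_pow]; nlinarith [sq_nonneg (Γ l)]
  have hIl : ∀ l, 𝔼 π : Equiv.Perm (Fin n),
      |∑ i, weight n p k (stdLevel n p l) i * ev c (prefixSet π (k i))| ≤ Γ l := fun l =>
    expect_abs_le_of_sq_le _ (hΓ0 l) (expect_sq_sum_mul_le _
      (fun i (π : Equiv.Perm (Fin n)) => ev c (prefixSet π (k i))) hk1)
  have htail2 : ∑ l ∈ (Iic n).filter (fun l => ¬ |stdLevel n p l| ≤ s), binWeight n p l ≤
      2 / Real.sqrt N := by
    rw [hs]; exact sum_binWeight_log_tail_le hp0.le hp1.le (by linarith) hlog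
  have h9N : 9 ≤ Real.sqrt N := by linarith
  refine abs_sum_sub_conditioned_le (Iic n) (binWeight n p) (fun l => |stdLevel n p l| ≤ s)
    (fun l _ => binWeight_nonneg hp0.le hp1.le l) sum_binWeight _ _
    (fun l => B * (1 + |stdLevel n p l|) ^ (d + 1)) hr0 (by positivity)
    (fun l _ => by positivity) ?_ ?_ ?_ ?_ ?_ ?_
  · intro l hl
    refine (abs_expect_le _ _).trans (le_trans ?_ ((hFl l hl).trans (hΓ2 l)))
    exact expect_le_expect fun π _ => hφabs _
  · intro l hl
    refine (abs_expect_le _ _).trans (le_trans ?_ ((hIl l).trans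
      (le_trans (by linarith [hΓ0 l]) (hΓ2 l))))
    exact expect_le_expect fun π _ => hφabs _
  · intro l hl hgood
    rw [← expect_sub_distrib]
    refine (abs_expect_le _ _).trans ((expect_le_expect fun π _ => hφsub _ _).trans ?_)
    refine (hsys.expect_abs_sub_le hp0 hp1 hd hM hc hk1 (mem_Iic.1 hl) (hgood.trans hs9) hr0
      hr2).trans ?_
    exact div_le_div_of_nonneg_right (hΓle l) hr0.le
  · have hmom := sum_binWeight_mul_pow_le hp0.le hp1.le (by linarith : 1 ≤ binVar n p) (2 * d + 2)
    have h1 : ∀ l ∈ Iic n, binWeight n p l * (B * (1 + |stdLevel n p l|) ^ (d + 1)) ^ 2 =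
        B ^ 2 * (binWeight n p l * (1 + |stdLevel n p l|) ^ (2 * d + 2)) := by
      intro l _; ring
    rw [sum_congr rfl h1, ← mul_sum, mul_pow B]
    refine mul_le_mul_of_nonneg_left (hmom.trans ?_) (sq_nonneg B)
    have : (1 : ℝ) ≤ (2 * d + 2).factorial := by exact_mod_cast (2 * d + 2).factorial_pos
    nlinarith
  · refine htail2.trans ?_
    rw [div_pow, hr2]
    gcongr
    norm_num
  · refine htail2.trans ?_
    rw [div_le_div_iff₀ hsN (by norm_num)]; linarith

end Assembly

end SliceInterp

open SliceInterp in
theorem mainTheorem3 :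
    ∃ K C : ℝ, ∃ A : ℕ, 0 < K ∧ 0 < C ∧
      ∀ (n d : ℕ) (p : unitInterval) (f : MvPolynomial (Fin n) ℝ) (η M : ℝ) (k : Fin (d + 1) → ℕ),
        0 < p → p < 1 →
        SliceInterp.IsMultilinear f → f.totalDegree ≤ d →
        1 ≤ d →
        (d : ℝ) ≤ K * Real.sqrt (SliceInterp.binVar n p / Real.log (SliceInterp.binVar n p)) →
        SliceInterp.IsSystem n p η M k →
        M ≤ Real.sqrt (SliceInterp.binVar n p) / (9 * d) →
        (∀ i, SliceInterp.l2Norm (SliceInterp.sliceMeasure n (k i)) f ≤ 1) →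
        (∀ l : ℕ, l ≤ n → ∀ i,
          |SliceInterp.weight n p k (SliceInterp.stdLevel n p l) i| ≤
            (C * ((1 + |SliceInterp.stdLevel n p l|) * (M / η))) ^ d) ∧
        ∀ φ : ℝ → ℝ, LipschitzWith 1 φ →
          |(∫ x, φ (MvPolynomial.eval x f) ∂(SliceInterp.cubeMeasure n p)) -
            ∫ y, φ y ∂(SliceInterp.interpolated p f k
              (Real.sqrt (3 * Real.log (SliceInterp.binVar n p))))| ≤
          (C * ((d : ℝ) / (p * (1 - p)) * (M / η))) ^ (A * d) /
            (SliceInterp.binVar n p) ^ (1 / 4 : ℝ) := by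
  refine ⟨1 / 16, 5376, 7, by norm_num, by norm_num, ?_⟩
  intro n d p f η M k hp0 hp1 _ hdeg hd hdK hsys hM hnorm
  have hp0' : (0 : ℝ) < p := hp0
  have hp1' : (p : ℝ) < 1 := hp1
  have hη := hsys.eta_pos
  have hM1 := hsys.one_le_M
  have hd' : (1 : ℝ) ≤ d := by exact_mod_cast hd
  refine ⟨fun l _ i => (hsys.abs_weight_le _ i).trans ?_, fun φ hφ => ?_⟩
  · have : 0 ≤ (1 + |stdLevel n p l|) * (M / η) := by positivity
    exact pow_le_pow_left₀ this (by linarith) d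
  obtain ⟨c, hc, hev⟩ := exists_eval_eq_ev f hdeg
  obtain ⟨hN81, h9⟩ := hsys.binVar_ge hd hM
  have hlogpos : 0 < Real.log (binVar n p) := Real.log_pos (by linarith)
  have hlog : 256 * Real.log (binVar n p) ≤ binVar n p := by
    have h1 : 16 ≤ Real.sqrt (binVar n p / Real.log (binVar n p)) := by linarith
    have h2 := (Real.le_sqrt' (by norm_num)).1 h1
    rw [le_div_iff₀ hlogpos] at h2
    linarith
  have hk1 : ∀ i, Finset.expect Finset.univ
      (fun π : Equiv.Perm (Fin n) => ev c (prefixSet π (k i)) ^ 2) ≤ 1 := by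
    intro i
    have h1 := (Real.sqrt_le_left zero_le_one).1 (hnorm i)
    rw [integral_sliceMeasure (hsys.le_n i) (fun x => MvPolynomial.eval x f ^ 2), one_pow] at h1
    simpa only [hev] using h1
  have hmain := hsys.abs_sum_sub_interpolated_le hp0' hp1' hd hM hc hk1 hlog
    (φ := fun x => φ x - φ 0) (fun x y => by simpa [edist_sub_right] using hφ x y) (sub_self _) rfl
  have hcube : ∫ x, φ (MvPolynomial.eval x f) ∂(cubeMeasure n p) =
      ∑ l ∈ Finset.Iic n, binWeight n p l * Finset.expect Finset.univ
        (fun π : Equiv.Perm (Fin n) => φ (ev c (prefixSet π l))) := by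
    rw [integral_cubeMeasure p (fun x => φ (MvPolynomial.eval x f))
      (hφ.continuous.comp (MvPolynomial.continuous_eval f)).measurable]
    simp only [hev]
  have hinterp := integral_interpolated p f k
    (Real.sqrt (3 * Real.log (binVar n p))) φ hφ.continuous.measurable
  rw [integral_condBinomial] at hinterp
  simp only [chain_eq_indicatorPoint, hev] at hinterp
  set s := Real.sqrt (3 * Real.log (binVar n p)) with hs
  -- The good levels carry positive mass, so the normalisation is not degenerate.
  have hZ : ∑ l ∈ (Finset.Iic n).filter (fun l => |stdLevel n p l| ≤ s), binWeight n p l ≠ 0 := by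
    have hbad := sum_binWeight_log_tail_le hp0'.le hp1'.le (by linarith) hlog
    have hone := Finset.sum_filter_add_sum_filter_not (Finset.Iic n)
      (fun l => |stdLevel n p l| ≤ s) (binWeight n p)
    rw [sum_binWeight] at hone
    have h9N : 9 ≤ Real.sqrt (binVar n p) := by nlinarith
    have : 2 / Real.sqrt (binVar n p) ≤ 2 / 9 := by gcongr
    rw [← hs] at hbad
    linarith
  simp only [Finset.expect_sub_distrib, Fintype.expect_const, mul_sub, Finset.sum_sub_distrib,
    ← Finset.sum_mul, sum_binWeight, sub_div, one_mul] at hmain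
  rw [mul_div_cancel_left₀ _ hZ, sub_sub_sub_cancel_right] at hmain
  rw [hcube, hinterp]
  refine hmain.trans (div_le_div_of_nonneg_right ?_ (Real.rpow_nonneg (by linarith) _))
  have hρ : M ≤ M / η := (le_div_iff₀ hη).2 (by nlinarith [hsys.eta_le_one])
  refine factorial_mul_bound_le hd hM1 hρ ?_
  have hpq : 0 < (p : ℝ) * (1 - p) := mul_pos hp0' (by linarith)
  refine mul_le_mul_of_nonneg_right ((le_div_iff₀ hpq).2 ?_) (by positivity)
  exact mul_le_of_le_one_right (by positivity) (by nlinarith)
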